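/- Let $n,p$ be integers with $1\le p\le n-2$, and let $\mathbb{H}^{2n+p}$ denote the hyperbolic space of dimension $2n+p$ and constant sectional curvature $-1$. (a) Let $(M^{2n},\langle\,,\rangle,J)$ be a Kaehler manifold of real dimension $2n$ (a smooth Riemannian manifold with a smooth orthogonal almost complex structure $J$ that is parallel for the Levi-Civita connection), and let $f\colon M^{2n}\to\mathbb{H}^{2n+p}$ be a smooth isometric immersion. Then at every point $x\in M^{2n}$ there is a complex (that is, $J$-invariant) vector subspace $V^{2\ell}\subset T_xM$ of real dimension $2\ell$, with $\ell\ge n-p+1$, such that for every $S\in V^{2\ell}$ the sectional curvature of $M^{2n}$ satisfies $K(S,JS)\le 0$ (if $S\ne 0$) and the Ricci curvature satisfies $\mathrm{Ric}(S)\le 0$, where $\mathrm{Ric}(S)$ is the trace of $X\mapsto R(X,S)S$. (b) The estimate is sharp, for each of the two curvatures: for all such $n$ and $p$ there are a connected Kaehler manifold $M^{2n}$, a smooth isometric immersion $f\colon M^{2n}\to\mathbb{H}^{2n+p}$ and a point $x\in M^{2n}$ such that every complex vector subspace $V^{2\ell}\subset T_xM$ on which $K(S,JS)\le 0$ for all $0\neq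 S\in V^{2\ell}$ has $\ell\le n-p+1$, and every complex vector subspace $V^{2\ell}\subset T_xM$ on which $\mathrm{Ric}(S)\le 0$ for all $S\in V^{2\ell}$ has $\ell\le n-p+1$. -/

import Mathlib

open scoped Manifold ContDiff

set_option maxSynthPendingDepth 3

noncomputable section

namespace KaehlerHyperbolic

/-! ### Riemannian geometry of a metric on an open set of a vector space -/

section LocalGeometry

variable {E : Type*} [NormedAddCommGroup E] [NormedSpace ℝ E]

/-- The lowered Christoffel symbols of a metric `G`:
`(u, v, w) ↦ (1/2) (∂_u G(v, w) + ∂_v G(u, w) - ∂_w G(u, v))`. -/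
def koszul (G : E → E →L[ℝ] E →L[ℝ] ℝ) (y : E) : E →L[ℝ] E →L[ℝ] E →L[ℝ] ℝ :=
  let D : E →L[ℝ] E →L[ℝ] E →L[ℝ] ℝ := fderiv ℝ G y
  let T : E →L[ℝ] E →L[ℝ] E →L[ℝ] ℝ :=
    ((ContinuousLinearMap.flipₗᵢ ℝ E E ℝ).toContinuousLinearEquiv :
      (E →L[ℝ] E →L[ℝ] ℝ) →L[ℝ] (E →L[ℝ] E →L[ℝ] ℝ)) ∘L D.flip
  (1 / 2 : ℝ) • (D + D.flip - T)

theorem koszul_apply (G : E → E →L[ℝ] E →L[ℝ] ℝ) (y u v w : E) :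
    koszul G y u v w = (1 / 2 : ℝ) *
      (fderiv ℝ G y u v w + fderiv ℝ G y v u w - fderiv ℝ G y w u v) := rfl

/-- The Christoffel symbols `Γ_y(u, v) = (∇_u v)(y)` (for constant `u`, `v`) of the Levi-Civita
connection: the vector with `G_y(Γ_y(u, v), w) = koszul G y u v w` for all `w`. -/
def christoffel (G : E → E →L[ℝ] E →L[ℝ] ℝ) (y : E) : E →L[ℝ] E →L[ℝ] E :=
  (ContinuousLinearMap.compL ℝ E (E →L[ℝ] ℝ) E (G y).inverse) ∘L koszul G y

theorem christoffel_apply (G : E → E →L[ℝ] E →L[ℝ] ℝ) (y u v : E) :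
    christoffel G y u v = (G y).inverse (koszul G y u v) := rfl

/-- The curvature `R(u, v) w = ∇_u ∇_v w - ∇_v ∇_u w - ∇_[u, v] w` of the metric `G` at `y`. -/
def localCurvature (G : E → E →L[ℝ] E →L[ℝ] ℝ) (y u v w : E) : E :=
  fderiv ℝ (christoffel G) y u v w - fderiv ℝ (christoffel G) y v u w
    + christoffel G y u (christoffel G y v w) - christoffel G y v (christoffel G y u w)

theorem localCurvature_add (G : E → E →L[ℝ] E →L[ℝ] ℝ) (y u u' v w : E) :
    localCurvature G y (u + u') v w = localCurvature G y u v w + localCurvature G y u' v w := by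
  simp only [localCurvature, map_add, add_apply]
  abel

theorem localCurvature_smul (G : E → E →L[ℝ] E →L[ℝ] ℝ) (c : ℝ) (y u v w : E) :
    localCurvature G y (c • u) v w = c • localCurvature G y u v w := by
  simp only [localCurvature, map_smul, smul_apply, smul_add, smul_sub]

/-- The covariant derivative `(∇_u J) v` at `y` of a field `J` of endomorphisms. -/
def localCovDerivEnd (G : E → E →L[ℝ] E →L[ℝ] ℝ) (J : E → E →L[ℝ] E) (y u v : E) : E :=
  fderiv ℝ J y u v + christoffel G y u (J y v) - J y (christoffel G y u v)

end LocalGeometry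

/-! ### Riemannian geometry of a manifold -/

/-- The model space of a manifold of real dimension `2 * n`. -/
abbrev Model (n : ℕ) : Type := EuclideanSpace ℝ (Fin (2 * n))

section Manifold

variable {n : ℕ} {M : Type*} [TopologicalSpace M] [ChartedSpace (Model n) M]
  [IsManifold 𝓘(ℝ, Model n) ∞ M]

variable (n M) in
/-- Smooth Riemannian metrics on a manifold `M` of dimension `2 * n`. -/
abbrev RiemannianMetric : Type _ :=
  Bundle.ContMDiffRiemannianMetric 𝓘(ℝ, Model n) ∞ (Model n)
    (fun x : M ↦ TangentSpace 𝓘(ℝ, Model n) x)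

/-- The differential at `y` of the inverse of the preferred chart around `x₀`. -/
def chartSymmDeriv (x₀ : M) (y : Model n) : Model n →L[ℝ]
    TangentSpace 𝓘(ℝ, Model n) ((extChartAt 𝓘(ℝ, Model n) x₀).symm y) :=
  mfderiv 𝓘(ℝ, Model n) 𝓘(ℝ, Model n) (extChartAt 𝓘(ℝ, Model n) x₀).symm y

/-- The differential, at the point with coordinates `y`, of the preferred chart around `x₀`. -/
def chartDeriv (x₀ : M) (y : Model n) :
    TangentSpace 𝓘(ℝ, Model n) ((extChartAt 𝓘(ℝ, Model n) x₀).symm y) →L[ℝ] Model n :=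
  mfderiv 𝓘(ℝ, Model n) 𝓘(ℝ, Model n) (extChartAt 𝓘(ℝ, Model n) x₀)
    ((extChartAt 𝓘(ℝ, Model n) x₀).symm y)

/-- The metric `g` in the preferred chart around `x₀` (meaningful on the target of the chart). -/
def chartMetric (g : RiemannianMetric n M) (x₀ : M) (y : Model n) :
    Model n →L[ℝ] Model n →L[ℝ] ℝ :=
  ContinuousLinearMap.bilinearComp (E := Model n) (F := Model n)
    (g.inner ((extChartAt 𝓘(ℝ, Model n) x₀).symm y))
    (chartSymmDeriv x₀ y) (chartSymmDeriv x₀ y)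

/-- A field of endomorphisms of the tangent spaces in the preferred chart around `x₀`. -/
def chartEnd (J : ∀ x : M, TangentSpace 𝓘(ℝ, Model n) x →L[ℝ] TangentSpace 𝓘(ℝ, Model n) x)
    (x₀ : M) (y : Model n) : Model n →L[ℝ] Model n :=
  chartDeriv x₀ y ∘L J ((extChartAt 𝓘(ℝ, Model n) x₀).symm y) ∘L chartSymmDeriv x₀ y

/-- The curvature tensor of `g` at `x`, computed in the preferred chart around `x`. The tangent
space at `x` is by definition the model space, and the differential at `x` of the preferred chart
around `x` is the identity. -/
def curvature (g : RiemannianMetric n M) (x : M) (u v w : TangentSpace 𝓘(ℝ, Model n) x) :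
    TangentSpace 𝓘(ℝ, Model n) x :=
  localCurvature (E := Model n) (chartMetric g x) (extChartAt 𝓘(ℝ, Model n) x x) u v w

/-- The sectional curvature `K(u, v)` of the plane spanned by `u` and `v` (meaningful for linearly
independent `u` and `v`). -/
def sectionalCurvature (g : RiemannianMetric n M) (x : M) (u v : TangentSpace 𝓘(ℝ, Model n) x) :
    ℝ :=
  g.inner x (curvature g x u v v) u
    / (g.inner x u u * g.inner x v v - g.inner x u v ^ 2)

/-- The linear map `X ↦ R(X, v) w`. -/
def curvatureOperator (g : RiemannianMetric n M) (x : M) (v w : TangentSpace 𝓘(ℝ, Model n) x) :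
    TangentSpace 𝓘(ℝ, Model n) x →ₗ[ℝ] TangentSpace 𝓘(ℝ, Model n) x where
  toFun X := curvature g x X v w
  map_add' X Y := localCurvature_add (E := Model n) _ _ X Y v w
  map_smul' c X := localCurvature_smul (E := Model n) _ c _ X v w

/-- The Ricci curvature `Ric(v) = Ric(v, v)`, the trace of `X ↦ R(X, v) v`. -/
def ricci (g : RiemannianMetric n M) (x : M) (v : TangentSpace 𝓘(ℝ, Model n) x) : ℝ :=
  LinearMap.trace ℝ (TangentSpace 𝓘(ℝ, Model n) x) (curvatureOperator g x v v)

variable (n M) in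
/-- A Kaehler structure: a Riemannian metric together with a smooth orthogonal almost complex
structure that is parallel for the Levi-Civita connection. -/
structure KaehlerStructure where
  /-- The Riemannian metric. -/
  metric : RiemannianMetric n M
  /-- The complex structure of the tangent spaces. -/
  J : ∀ x : M, TangentSpace 𝓘(ℝ, Model n) x →L[ℝ] TangentSpace 𝓘(ℝ, Model n) x
  contMDiff_J : ContMDiff 𝓘(ℝ, Model n) (𝓘(ℝ, Model n).prod 𝓘(ℝ, Model n →L[ℝ] Model n)) ∞
    (fun x : M ↦ Bundle.TotalSpace.mk' (Model n →L[ℝ] Model n)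
      (E := fun x : M ↦ TangentSpace 𝓘(ℝ, Model n) x →L[ℝ] TangentSpace 𝓘(ℝ, Model n) x) x (J x))
  J_J : ∀ (x : M) (v : TangentSpace 𝓘(ℝ, Model n) x), J x (J x v) = -v
  inner_J_J : ∀ (x : M) (u v : TangentSpace 𝓘(ℝ, Model n) x),
    metric.inner x (J x u) (J x v) = metric.inner x u v
  parallel_J : ∀ x₀ : M, ∀ y ∈ (extChartAt 𝓘(ℝ, Model n) x₀).target, ∀ u v : Model n,
    localCovDerivEnd (chartMetric metric x₀) (chartEnd J x₀) y u v = 0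

/-- A complex vector subspace of the tangent space at `x`, of complex dimension `ℓ`. -/
def KaehlerStructure.IsComplexSubspace (K : KaehlerStructure n M) (x : M)
    (V : Submodule ℝ (TangentSpace 𝓘(ℝ, Model n) x)) (ℓ : ℕ) : Prop :=
  (∀ S ∈ V, K.J x S ∈ V) ∧ Module.finrank ℝ V = 2 * ℓ

end Manifold

/-! ### The hyperbolic space of curvature `-1` -/

/-- The flat Lorentzian space of dimension `N + 1`; the first coordinate is the time coordinate. -/
abbrev LorentzSpace (N : ℕ) : Type := ℝ × EuclideanSpace ℝ (Fin N)

/-- The Lorentzian inner product. -/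
def lorentz {N : ℕ} (a b : LorentzSpace N) : ℝ := inner ℝ a.2 b.2 - a.1 * b.1

/-- The hyperbolic space of dimension `N` and curvature `-1`: the upper sheet of the hyperboloid
`⟨a, a⟩ = -1`, with the metric induced by the Lorentzian inner product. -/
def HyperbolicSpace (N : ℕ) : Type := {a : LorentzSpace N // lorentz a a = -1 ∧ 0 < a.1}

/-- The inclusion of the hyperbolic space in the Lorentzian space. -/
def HyperbolicSpace.incl {N : ℕ} (a : HyperbolicSpace N) : LorentzSpace N := a.1

/-- A smooth isometric immersion of `(M, g)` in the hyperbolic space. The hyperbolic space is an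
embedded submanifold of the Lorentzian space with the induced metric, so that smoothness and the
preservation of the metric are tested on the composition with the inclusion. -/
structure IsIsometricImmersion {n N : ℕ} {M : Type*} [TopologicalSpace M]
    [ChartedSpace (Model n) M] [IsManifold 𝓘(ℝ, Model n) ∞ M]
    (g : RiemannianMetric n M) (f : M → HyperbolicSpace N) : Prop where
  contMDiff : ContMDiff 𝓘(ℝ, Model n) 𝓘(ℝ, LorentzSpace N) ∞ (fun x ↦ (f x).incl)
  isometric : ∀ (x : M) (u v : TangentSpace 𝓘(ℝ, Model n) x),
    lorentz (mfderiv 𝓘(ℝ, Model n) 𝓘(ℝ, LorentzSpace N) (fun x ↦ (f x).incl) x u)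
      (mfderiv 𝓘(ℝ, Model n) 𝓘(ℝ, LorentzSpace N) (fun x ↦ (f x).incl) x v) = g.inner x u v

end KaehlerHyperbolic

end

/-! Estimate. Regard `f` as a map `F` into Lorentzian space. Its normal space `W` at a point has
dimension `p + 1`, is Lorentzian, and contains the position vector `f`, with `B (a X Y) f = -G X Y`
for the second fundamental form `a`. By the Gauss equation, the fact that curvature commutes with
`J` becomes an identity for `a`. It makes the `J`-invariant part `h X Y = a X Y + a (J X) (J Y)`
flat: the pair `(h X Y, h X (J Y))` is flat for the form `B ⊕ -B` on `W × W`.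

At a regular vector `X`, flatness makes the values `h Y Y`, for `Y` in the kernel of the pair at
`X`, null and mutually orthogonal (`IsFlatHermitian.exists_ker_isotropic`). In Lorentzian signature
they are therefore `G Y Y • v` for a single null vector `v`. Since `2 (p + 1) < 2 n`, the kernels at
`X` and at any `Z` share a nonzero vector (`IsFlatHermitian.exists_ker_inter_ker`), and flatness
then gives `v ⊥ h Z Z` for every `Z`. Hence `k = h - G v` is again flat, with values in the positive
definite space orthogonal to `f` and `v`, of dimension `p - 1`. At a regular vector for `k` the
kernel is a complex subspace of complex codimension at most `p - 1`, and there `h S S = G S S • v`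
(`IsKaehlerSecondForm.exists_subspace`). Both curvature signs follow from the inequality `G X Y * B
v (a X Y) ≤ B (a X Y) (a X Y)`.

Sharpness. The product of `p - 1` unit spheres in `ℝ³` and `n - p + 1` planes lies in a Euclidean
space of dimension `2 n + p - 1`, which is a horosphere of the hyperbolic space. At the origin `K(S,
J S)` and `Ric S` are nonnegative, and vanish only if `S` has no spherical component. -/

noncomputable section

namespace KaehlerHyperbolic

/-! ### Flat Hermitian forms -/

section Regular

variable {V U : Type*} [AddCommGroup V] [Module ℝ V]
  [NormedAddCommGroup U] [NormedSpace ℝ U] [FiniteDimensional ℝ U]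

/-- For a bilinear map `b` there is a *regular* vector `X` (one for which `b X` has maximal rank):
every `b Z` maps the kernel of `b X` into the range of `b X`. -/
theorem exists_forall_ker_mem_range (b : V →ₗ[ℝ] V →ₗ[ℝ] U) :
    ∃ X, ∀ Y, b X Y = 0 → ∀ Z, b Z Y ∈ LinearMap.range (b X) := by
  obtain ⟨X, hX⟩ : ∃ X, ∀ X', Module.finrank ℝ (LinearMap.range (b X')) ≤
      Module.finrank ℝ (LinearMap.range (b X)) := by
    have hbdd : BddAbove (Set.range fun X ↦ Module.finrank ℝ (LinearMap.range (b X))) :=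
      ⟨Module.finrank ℝ U, by rintro _ ⟨X, rfl⟩; exact Submodule.finrank_le _⟩
    obtain ⟨X, hX⟩ := Nat.sSup_mem (Set.range_nonempty _) hbdd
    exact ⟨X, fun X' ↦ (le_csSup hbdd ⟨X', rfl⟩).trans hX.ge⟩
  refine ⟨X, fun Y hY Z ↦ ?_⟩
  by_contra hu
  let β := Module.finBasis ℝ (LinearMap.range (b X))
  choose e he using fun i ↦ (β i).2
  -- If `b Z Y` were outside the range of `b X`, adjoining it to a basis of that range would give an
  -- independent family, still independent after a small perturbation. For `t ≠ 0` the family `w t`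
  -- lies in the range of `b (X + t • Z)`, since that map sends `t⁻¹ • Y` to `b Z Y`; the maximal
  -- rank would be exceeded.
  let w : ℝ → Option (Fin (Module.finrank ℝ (LinearMap.range (b X)))) → U := fun t o ↦
    Option.casesOn' o (b Z Y) (fun i ↦ b X (e i) + t • b Z (e i))
  have hw0 : LinearIndependent ℝ (w 0) := by
    have h1 : LinearIndependent ℝ fun i ↦ b X (e i) := by
      simp only [he]
      exact β.linearIndependent.map' (Submodule.subtype _) (Submodule.ker_subtype _)
    have h2 : b Z Y ∉ Submodule.span ℝ (Set.range fun i ↦ b X (e i)) := fun h ↦ hu <|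
      Submodule.span_le.2 (by rintro _ ⟨i, rfl⟩; exact LinearMap.mem_range_self _ _) h
    simpa [w] using h1.option h2
  have hcont : Continuous w := by
    refine continuous_pi fun o ↦ ?_
    cases o with
    | none => exact continuous_const
    | some i =>
      change Continuous fun t : ℝ ↦ b X (e i) + t • b Z (e i)
      fun_prop
  have hev : ∀ᶠ t in nhds (0 : ℝ), LinearIndependent ℝ (w t) :=
    (isOpen_setOfPred_linearIndependent.preimage hcont).mem_nhds hw0
  obtain ⟨t, ht, ht0⟩ := ((hev.filter_mono nhdsWithin_le_nhds).and
    (self_mem_nhdsWithin : {(0 : ℝ)}ᶜ ∈ nhdsWithin (0 : ℝ) {0}ᶜ)).exists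
  have hmem : ∀ o, w t o ∈ LinearMap.range (b (X + t • Z)) := by
    rintro (_ | i)
    · refine ⟨t⁻¹ • Y, ?_⟩
      have : t ≠ 0 := ht0
      simp [hY, w, smul_smul, this]
    · exact ⟨e i, by simp [w]⟩
  have hli : LinearIndependent ℝ
      fun o ↦ (⟨w t o, hmem o⟩ : LinearMap.range (b (X + t • Z))) :=
    LinearIndependent.of_comp (Submodule.subtype _) ht
  have := hli.fintype_card_le_finrank.trans (hX _)
  simp at this

end Regular

section Flat

variable {V W : Type*} [AddCommGroup V] [Module ℝ V] [NormedAddCommGroup W] [NormedSpace ℝ W]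

/-- The real form `(X, Y) ↦ (h X Y, h X (J Y))` of the Hermitian form with real part `h`. -/
def hermitianPair (J : V →ₗ[ℝ] V) (h : V →ₗ[ℝ] V →ₗ[ℝ] W) : V →ₗ[ℝ] V →ₗ[ℝ] W × W :=
  LinearMap.mk₂ ℝ (fun X Y ↦ (h X Y, h X (J Y))) (by simp) (by simp) (by simp) (by simp)

@[simp]
theorem hermitianPair_apply (J : V →ₗ[ℝ] V) (h : V →ₗ[ℝ] V →ₗ[ℝ] W) (X Y : V) :
    hermitianPair J h X Y = (h X Y, h X (J Y)) := rfl

/-- A symmetric `J`-invariant bilinear map whose associated Hermitian form is flat. -/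
structure IsFlatHermitian (J : V →ₗ[ℝ] V) (B : LinearMap.BilinForm ℝ W)
    (h : V →ₗ[ℝ] V →ₗ[ℝ] W) : Prop where
  symm : ∀ X Y, h X Y = h Y X
  invariant : ∀ X Y, h (J X) (J Y) = h X Y
  flat : ∀ X Y Z T, B (h X Y) (h Z T) - B (h X (J Y)) (h Z (J T)) =
    B (h X T) (h Z Y) - B (h X (J T)) (h Z (J Y))

variable {J : V →ₗ[ℝ] V} {B : LinearMap.BilinForm ℝ W} {h : V →ₗ[ℝ] V →ₗ[ℝ] W}

theorem IsFlatHermitian.apply_J_self (hh : IsFlatHermitian J B h) (hJ : ∀ X, J (J X) = -X)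
    (Y : V) : h Y (J Y) = 0 := by
  have h1 := hh.invariant Y (J Y)
  rw [hJ, map_neg, hh.symm (J Y) Y] at h1
  have h2 : (2 : ℝ) • h Y (J Y) = 0 := by
    rw [two_smul]
    nth_rw 1 [← h1]
    simp
  simpa using h2

/-- At a regular `X` the pair at `(Y, Y)`, which is `(h Y Y, 0)`, equals the pair at `(X, T)` for
some `T`. Flatness exchanges `T` with `Y'`, and then every term contains `h X Y'` or `h X (J Y')`,
both zero. -/
theorem IsFlatHermitian.exists_ker_isotropic [FiniteDimensional ℝ W]
    (hh : IsFlatHermitian J B h) (hJ : ∀ X, J (J X) = -X) :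
    ∃ X, ∀ Y, hermitianPair J h X Y = 0 → ∀ Y', hermitianPair J h X Y' = 0 →
      B (h Y Y) (h Y' Y') = 0 := by
  obtain ⟨X, hX⟩ := exists_forall_ker_mem_range (hermitianPair J h)
  refine ⟨X, fun Y hY Y' hY' ↦ ?_⟩
  obtain ⟨T, hT⟩ := hX Y hY Y
  simp only [hermitianPair_apply, Prod.mk.injEq, Prod.mk_eq_zero] at hT hY'
  have := hh.flat X T Y' Y'
  simpa [hT.1, hT.2, hY'.1, hY'.2, hh.apply_J_self hJ] using this

/-- By flatness the pair at `Z` maps the kernel at `X` into the `C`-orthogonal of the range at `X`,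
where `C = B ⊕ -B`. If `r` is the rank at `X`, this goes from dimension `dim V - r` to dimension `2
dim W - r`, which is smaller. -/
theorem IsFlatHermitian.exists_ker_inter_ker [FiniteDimensional ℝ V] [FiniteDimensional ℝ W]
    (hh : IsFlatHermitian J B h) (hBs : ∀ a b, B a b = B b a) (hB : ∀ a, (∀ b, B a b = 0) → a = 0)
    (hdim : 2 * Module.finrank ℝ W < Module.finrank ℝ V) (X Z : V) :
    ∃ Y, Y ≠ 0 ∧ hermitianPair J h X Y = 0 ∧ hermitianPair J h Z Y = 0 := by
  let C : LinearMap.BilinForm ℝ (W × W) :=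
    B.compl₁₂ (LinearMap.fst ℝ W W) (LinearMap.fst ℝ W W) -
      B.compl₁₂ (LinearMap.snd ℝ W W) (LinearMap.snd ℝ W W)
  have hC : ∀ a b, C a b = B a.1 b.1 - B a.2 b.2 := fun a b ↦ rfl
  have hsym : C.IsSymm := ⟨fun a b ↦ by simp [hC, hBs a.1, hBs a.2]⟩
  have hnd : C.Nondegenerate := by
    refine (LinearMap.IsRefl.nondegenerate_iff_separatingLeft hsym.isRefl).2 fun a ha ↦ ?_
    refine Prod.ext (hB _ fun b ↦ ?_) (hB _ fun b ↦ ?_)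
    · simpa [hC] using ha (b, 0)
    · simpa [hC] using ha (0, b)
  set R := LinearMap.range (hermitianPair J h X)
  set N := LinearMap.ker (hermitianPair J h X)
  have hmaps : ∀ Y ∈ N, hermitianPair J h Z Y ∈ C.orthogonal R := by
    rintro Y hY _ ⟨T, rfl⟩
    have hY' : hermitianPair J h X Y = 0 := hY
    simp only [hermitianPair_apply, Prod.mk_eq_zero] at hY'
    have := hh.flat X T Z Y
    change C _ _ = 0
    simpa [hC, hY'.1, hY'.2] using this
  let φ : N →ₗ[ℝ] C.orthogonal R := (hermitianPair J h Z).restrict hmaps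
  have hlt : Module.finrank ℝ (C.orthogonal R) < Module.finrank ℝ N := by
    have h1 := C.finrank_orthogonal hnd R
    have h2 := (hermitianPair J h X).finrank_range_add_finrank_ker
    have h3 : Module.finrank ℝ R ≤ _ := Submodule.finrank_le R
    rw [Module.finrank_prod] at h1 h3
    change Module.finrank ℝ R + Module.finrank ℝ N = _ at h2
    omega
  obtain ⟨Y, hY, hY0⟩ := (Submodule.ne_bot_iff _).1
    (LinearMap.ker_ne_bot_of_finrank_lt (f := φ) hlt)
  refine ⟨Y, by simpa using hY0, Y.2, ?_⟩
  simpa [φ, Subtype.ext_iff] using hY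

end Flat

/-! ### Second fundamental forms of Kaehler type in Lorentzian signature -/

section SecondForm

variable {V W : Type*} [AddCommGroup V] [Module ℝ V] [NormedAddCommGroup W] [NormedSpace ℝ W]

/-- The algebraic properties of the second fundamental form `a`, with values in a Lorentzian normal
space `(W, B)`, of a Kaehler submanifold of the hyperbolic space at the point `f` (which is a
timelike unit vector normal to the submanifold). -/
structure IsKaehlerSecondForm (J : V →ₗ[ℝ] V) (G : LinearMap.BilinForm ℝ V)
    (B : LinearMap.BilinForm ℝ W) (f : W) (a : V →ₗ[ℝ] V →ₗ[ℝ] W) : Prop where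
  J_J : ∀ X, J (J X) = -X
  metric_symm : ∀ X Y, G X Y = G Y X
  metric_pos : ∀ X, X ≠ 0 → 0 < G X X
  metric_J : ∀ X Y, G (J X) (J Y) = G X Y
  form_symm : ∀ v w, B v w = B w v
  form_self : B f f = -1
  form_pos : ∀ w, B w f = 0 → w ≠ 0 → 0 < B w w
  symm : ∀ X Y, a X Y = a Y X
  apply_f : ∀ X Y, B (a X Y) f = -G X Y
  kaehler : ∀ X Y Z T, B (a X (J T)) (a Y (J Z)) - B (a X (J Z)) (a Y (J T)) =
    B (a X T) (a Y Z) - B (a X Z) (a Y T)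

/-- The `J`-invariant part (up to a factor `2`) of a bilinear map. -/
def invariantPart (J : V →ₗ[ℝ] V) (a : V →ₗ[ℝ] V →ₗ[ℝ] W) : V →ₗ[ℝ] V →ₗ[ℝ] W :=
  a + a.compl₁₂ J J

@[simp]
theorem invariantPart_apply (J : V →ₗ[ℝ] V) (a : V →ₗ[ℝ] V →ₗ[ℝ] W) (X Y : V) :
    invariantPart J a X Y = a X Y + a (J X) (J Y) := rfl

namespace IsKaehlerSecondForm

variable {J : V →ₗ[ℝ] V} {G : LinearMap.BilinForm ℝ V} {B : LinearMap.BilinForm ℝ W} {f : W}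
  {a : V →ₗ[ℝ] V →ₗ[ℝ] W}

theorem form_nonneg (H : IsKaehlerSecondForm J G B f a) {w : W} (hw : B w f = 0) : 0 ≤ B w w := by
  by_cases h : w = 0
  · simp [h]
  · exact (H.form_pos w hw h).le

theorem eq_zero_of_form_self_eq_zero (H : IsKaehlerSecondForm J G B f a) {w : W} (hw : B w f = 0)
    (h : B w w = 0) : w = 0 := by
  by_contra h0
  exact (H.form_pos w hw h0).ne' h

theorem form_nondegenerate (H : IsKaehlerSecondForm J G B f a) (w : W) (hw : ∀ b, B w b = 0) :
    w = 0 :=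
  H.eq_zero_of_form_self_eq_zero (hw f) (hw w)

theorem isFlatHermitian (H : IsKaehlerSecondForm J G B f a) :
    IsFlatHermitian J B (invariantPart J a) where
  symm X Y := by simp [H.symm X Y, H.symm (J X)]
  invariant X Y := by simp [H.J_J, add_comm]
  flat X Y Z T := by
    -- Curvature terms with first pair `(X, Z)`, `(J X, J Z)`, `(X, J Z)`, `(J X, Z)`: together they
    -- account for all the products in the expansion of `h`.
    have k1 := H.kaehler X Z T Y
    have k2 := H.kaehler (J X) (J Z) T Y
    have k3 := H.kaehler X (J Z) T (J Y)
    have k4 := H.kaehler (J X) Z T (J Y)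
    simp only [invariantPart_apply, H.J_J, map_neg, map_add, LinearMap.add_apply,
      LinearMap.neg_apply] at k1 k2 k3 k4 ⊢
    linear_combination k2 - k1 - k3 - k4

theorem invariantPart_apply_f (H : IsKaehlerSecondForm J G B f a) (X Y : V) :
    B (invariantPart J a X Y) f = -2 * G X Y := by
  simp only [invariantPart_apply, map_add, LinearMap.add_apply, H.apply_f, H.metric_J]
  ring

theorem metric_apply_J_self (H : IsKaehlerSecondForm J G B f a) (X : V) : G X (J X) = 0 := by
  have h1 := H.metric_J X (J X)
  rw [H.J_J, map_neg, H.metric_symm (J X)] at h1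
  linarith

/-- A reverse Cauchy-Schwarz inequality for values of the second fundamental form. -/
theorem metric_mul_le (H : IsKaehlerSecondForm J G B f a) {v : W} (hvv : B v v = 0)
    (hvf : B v f = -2) (X Y : V) : G X Y * B v (a X Y) ≤ B (a X Y) (a X Y) := by
  -- The multiple of `v` cancels the component along `f`, so the difference is spacelike; as `v` is
  -- null, only the cross term survives in its square.
  have h1 : B (a X Y - (G X Y / 2) • v) f = 0 := by
    simp only [map_sub, LinearMap.sub_apply, H.apply_f, map_smul, LinearMap.smul_apply, hvf,
      smul_eq_mul]
    ring
  have h2 := H.form_nonneg h1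
  simp only [map_sub, LinearMap.sub_apply, map_smul, LinearMap.smul_apply, hvv, smul_eq_mul,
    H.form_symm (a X Y) v] at h2
  linarith

/-- Substituting `a (J S) (J S) = G S S • v - a S S` turns the left side into `G S S * B v (a S S)`
minus the squares of `a S S` and `a S (J S)`. The inequality `metric_mul_le` bounds the first square
below; for the second its left side vanishes because `S ⊥ J S`. -/
theorem sectional_nonpos (H : IsKaehlerSecondForm J G B f a) {v : W} (hvv : B v v = 0)
    (hvf : B v f = -2) {S : V} (hS : invariantPart J a S S = G S S • v) :
    B (a S S) (a (J S) (J S)) - B (a S (J S)) (a (J S) S) ≤ 0 := by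
  have h1 := H.metric_mul_le hvv hvf S S
  have h2 := H.metric_mul_le hvv hvf S (J S)
  rw [H.metric_apply_J_self, zero_mul] at h2
  have h3 : a (J S) (J S) = G S S • v - a S S := by rw [← hS, invariantPart_apply]; abel
  rw [h3, H.symm (J S) S]
  simp only [map_sub, map_smul, smul_eq_mul, H.form_symm (a S S) v]
  linarith

variable [FiniteDimensional ℝ V] [FiniteDimensional ℝ W]

/-- There is a null vector orthogonal to the `J`-invariant part of the second fundamental form. -/
theorem exists_null (H : IsKaehlerSecondForm J G B f a)
    (hdim : 2 * Module.finrank ℝ W < Module.finrank ℝ V) :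
    ∃ v, B v v = 0 ∧ B v f = -2 ∧ ∀ X Y, B v (invariantPart J a X Y) = 0 := by
  set h := invariantPart J a with h_def
  have hh : IsFlatHermitian J B h := H.isFlatHermitian
  obtain ⟨X, hX⟩ := hh.exists_ker_isotropic H.J_J
  have hker := hh.exists_ker_inter_ker H.form_symm H.form_nondegenerate hdim X
  obtain ⟨Y₀, hY₀, hXY₀, -⟩ := hker X
  have hG₀ := (H.metric_pos Y₀ hY₀).ne'
  set v := (G Y₀ Y₀)⁻¹ • h Y₀ Y₀ with v_def
  have hvf : B v f = -2 := by
    simp only [v_def, map_smul, LinearMap.smul_apply, h_def, H.invariantPart_apply_f, smul_eq_mul]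
    field_simp
  have hvv : B v v = 0 := by simp [v_def, hX Y₀ hXY₀ Y₀ hXY₀]
  have hquad : ∀ Z, B v (h Z Z) = 0 := by
    intro Z
    obtain ⟨Y, hY, hXY, hZY⟩ := hker Z
    have hG := (H.metric_pos Y hY).ne'
    -- Mutually orthogonal null vectors with the same product with `f` differ by a null vector
    -- orthogonal to `f`, which is zero.
    have hv : v = (G Y Y)⁻¹ • h Y Y := by
      rw [← sub_eq_zero]
      apply H.eq_zero_of_form_self_eq_zero
      · simp only [map_sub, LinearMap.sub_apply, hvf, map_smul, LinearMap.smul_apply, h_def,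
          H.invariantPart_apply_f, smul_eq_mul]
        field_simp
        ring
      · simp [v_def, hX Y₀ hXY₀ Y₀ hXY₀, hX Y hXY Y hXY, hX Y₀ hXY₀ Y hXY, hX Y hXY Y₀ hXY₀]
    simp only [hermitianPair_apply, Prod.mk_eq_zero] at hZY
    -- As `Y` is also in the kernel at `Z`, the right side of flatness vanishes and `h Y Y`, hence
    -- `v`, is orthogonal to `h Z Z`.
    have := hh.flat Y Y Z Z
    simp only [hZY.1, hZY.2, hh.apply_J_self H.J_J, map_zero, sub_zero] at this
    simp [hv, this]
  refine ⟨v, hvv, hvf, fun Y Z ↦ ?_⟩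
  have h1 := hquad (Y + Z)
  simp only [map_add, LinearMap.add_apply, hquad Y, hquad Z, hh.symm Z Y] at h1
  linarith

/-- On a complex subspace of codimension at most `dim W - 2` the `J`-invariant part of the second
fundamental form is a multiple of a null vector. -/
theorem exists_subspace (H : IsKaehlerSecondForm J G B f a)
    (hdim : 2 * Module.finrank ℝ W < Module.finrank ℝ V) :
    ∃ (v : W) (S : Submodule ℝ V), B v v = 0 ∧ B v f = -2 ∧
      (∀ X Y, B v (invariantPart J a X Y) = 0) ∧ (∀ X ∈ S, J X ∈ S) ∧
      Module.finrank ℝ V + 4 ≤ Module.finrank ℝ S + 2 * Module.finrank ℝ W ∧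
      ∀ X ∈ S, invariantPart J a X X = G X X • v := by
  obtain ⟨v, hvv, hvf, hv⟩ := H.exists_null hdim
  have hh := H.isFlatHermitian
  set h := invariantPart J a with h_def
  let k : V →ₗ[ℝ] V →ₗ[ℝ] W := h - G.compr₂ (LinearMap.toSpanSingleton ℝ W v)
  have hk : ∀ X Y, k X Y = h X Y - G X Y • v := fun X Y ↦ rfl
  -- Subtracting multiples of `v` changes no product, since `v` is null and orthogonal to `h`; so
  -- `k` inherits flatness.
  have hkk : ∀ X Y Z T, B (k X Y) (k Z T) = B (h X Y) (h Z T) := fun X Y Z T ↦ by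
    simp [hk, hvv, hv, H.form_symm _ v]
  have hkf : IsFlatHermitian J B k :=
    { symm := fun X Y ↦ by rw [hk, hk, hh.symm, H.metric_symm]
      invariant := fun X Y ↦ by rw [hk, hk, hh.invariant, H.metric_J]
      flat := fun X Y Z T ↦ by simp only [hkk]; exact hh.flat X Y Z T }
  obtain ⟨X, hX⟩ := hkf.exists_ker_isotropic H.J_J
  have hkvf : ∀ Y Z, B (k Y Z) f = 0 := fun Y Z ↦ by
    simp only [hk, map_sub, LinearMap.sub_apply, h_def, H.invariantPart_apply_f, map_smul,
      LinearMap.smul_apply, hvf, smul_eq_mul]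
    ring
  have hkvv : ∀ Y Z, B (k Y Z) v = 0 := fun Y Z ↦ by
    simp [hk, H.form_symm _ v, hvv, hv]
  refine ⟨v, LinearMap.ker (hermitianPair J k X), hvv, hvf, hv, fun Y hY ↦ ?_, ?_, fun Y hY ↦ ?_⟩
  · simp only [LinearMap.mem_ker, hermitianPair_apply, Prod.mk_eq_zero, H.J_J, map_neg,
      neg_eq_zero] at hY ⊢
    exact hY.symm
  -- The values of `k` lie in the kernel of `e`, of codimension `2`, so the pair for `k` has rank at
  -- most `2 (dim W - 2)`.
  · let e : W →ₗ[ℝ] ℝ × ℝ := (B.flip f).prod (B.flip v)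
    have he : ∀ w, e w = (B w f, B w v) := fun w ↦ rfl
    have hsurj : LinearMap.range e = ⊤ := by
      rw [LinearMap.range_eq_top]
      rintro ⟨s, t⟩
      refine ⟨(-t / 2) • f + (t / 4 - s / 2) • v, ?_⟩
      simp only [he, map_add, map_smul, LinearMap.add_apply, LinearMap.smul_apply, hvv, hvf,
        H.form_symm f v, H.form_self, smul_eq_mul, Prod.mk.injEq]
      constructor <;> ring
    have h1 := e.finrank_range_add_finrank_ker
    rw [hsurj, finrank_top, Module.finrank_prod, Module.finrank_self] at h1
    have h2 := (hermitianPair J k X).finrank_range_add_finrank_ker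
    have h3 : LinearMap.range (hermitianPair J k X) ≤
        LinearMap.range ((LinearMap.ker e).subtype.prodMap (LinearMap.ker e).subtype) := by
      rintro _ ⟨Y, rfl⟩
      exact ⟨(⟨k X Y, by simp [he, hkvf, hkvv]⟩, ⟨k X (J Y), by simp [he, hkvf, hkvv]⟩), rfl⟩
    have h4 := (Submodule.finrank_mono h3).trans (LinearMap.finrank_range_le _)
    rw [Module.finrank_prod] at h4
    omega
  · have h0 := H.eq_zero_of_form_self_eq_zero (hkvf Y Y) (hX Y hY Y hY)
    rwa [hk, sub_eq_zero] at h0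

end IsKaehlerSecondForm

/-- A basis that is orthonormal for a bilinear form. -/
def IsOrthonormalBasis {ι : Type*} [DecidableEq ι] (G : LinearMap.BilinForm ℝ V)
    (e : Module.Basis ι ℝ V) : Prop :=
  ∀ i j, G (e i) (e j) = if i = j then 1 else 0

/-! ### Orthonormal bases and traces -/

section Orthonormal

variable {ι : Type*} [DecidableEq ι] [Fintype ι] {G : LinearMap.BilinForm ℝ V}
  {e : Module.Basis ι ℝ V}

theorem IsOrthonormalBasis.repr_apply (he : IsOrthonormalBasis G e) (X : V) (i : ι) :
    e.repr X i = G X (e i) := by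
  have : G X (e i) = G (∑ j, e.repr X j • e j) (e i) := by rw [e.sum_repr]
  rw [this, map_sum, LinearMap.sum_apply]
  simp [he _ i]

theorem IsOrthonormalBasis.trace_eq_sum (he : IsOrthonormalBasis G e) (A : V →ₗ[ℝ] V) :
    LinearMap.trace ℝ V A = ∑ i, G (A (e i)) (e i) := by
  rw [LinearMap.trace_eq_matrix_trace ℝ e, Matrix.trace]
  simp [LinearMap.toMatrix_apply, he.repr_apply]

theorem IsOrthonormalBasis.sum_metric_mul (he : IsOrthonormalBasis G e) (φ : V →ₗ[ℝ] ℝ) (X : V) :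
    ∑ i, G X (e i) * φ (e i) = φ X := by
  conv_rhs => rw [← e.sum_repr X]
  simp [he.repr_apply]

theorem exists_isOrthonormalBasis [FiniteDimensional ℝ V] (hs : ∀ X Y, G X Y = G Y X)
    (hpos : ∀ X, X ≠ 0 → 0 < G X X) :
    ∃ e : Module.Basis (Fin (Module.finrank ℝ V)) ℝ V, IsOrthonormalBasis G e := by
  obtain ⟨b, hb⟩ := LinearMap.BilinForm.exists_orthogonal_basis (B := G) ⟨hs⟩
  have hpos' : ∀ i, 0 < G (b i) (b i) := fun i ↦ hpos _ (b.ne_zero i)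
  refine ⟨b.isUnitSMul (w := fun i ↦ (Real.sqrt (G (b i) (b i)))⁻¹)
    (fun i ↦ (inv_ne_zero (Real.sqrt_pos.2 (hpos' i)).ne').isUnit), fun i j ↦ ?_⟩
  simp only [Module.Basis.isUnitSMul_apply, map_smul, LinearMap.smul_apply, smul_eq_mul]
  split_ifs with hij
  · subst hij
    have h1 := Real.sqrt_pos.2 (hpos' i)
    have h2 := Real.mul_self_sqrt (hpos' i).le
    field_simp
    linarith
  · have : G (b i) (b j) = 0 := hb hij
    simp [this]

end Orthonormal

/-- Each of `G (A X) X` and `G (A (J X)) (J X)` has two expressions, through `S` and through `J S`.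
Adding all four produces `B (h X X) (h S S)`, which is zero because `h S S` is a multiple of `v`,
minus four squares bounded below by `metric_mul_le`. Summed over an orthonormal basis and its image
under `J`, these bounds contract to a multiple of `B v (h S S) = 0`. -/
theorem IsKaehlerSecondForm.trace_nonpos [FiniteDimensional ℝ V]
    {J : V →ₗ[ℝ] V} {G : LinearMap.BilinForm ℝ V} {B : LinearMap.BilinForm ℝ W} {f : W}
    {a : V →ₗ[ℝ] V →ₗ[ℝ] W} (H : IsKaehlerSecondForm J G B f a) {v : W} (hvv : B v v = 0)
    (hvf : B v f = -2) (hv : ∀ X Y, B v (invariantPart J a X Y) = 0)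
    {S : V} (hS : invariantPart J a S S = G S S • v) (A : V →ₗ[ℝ] V)
    (hA : ∀ X T, G (A X) T = B (a X T) (a S S) - B (a X S) (a S T)) :
    LinearMap.trace ℝ V A ≤ 0 := by
  obtain ⟨e, he⟩ := exists_isOrthonormalBasis H.metric_symm H.metric_pos
  let JJ : V ≃ₗ[ℝ] V := LinearEquiv.ofLinearMap J (-J) (by ext; simp [H.J_J]) (by ext; simp [H.J_J])
  have he' : IsOrthonormalBasis G (e.map JJ) := fun i j ↦ (H.metric_J _ _).trans (he i j)
  have hee : ∀ i, (e.map JJ) i = J (e i) := fun i ↦ rfl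
  have hq : ∀ X, G (A X) X = B (a X X) (a S S) - B (a X S) (a X S) := fun X ↦ by
    rw [hA, H.symm S X]
  -- This is the curvature symmetry `⟨R(JX, S)S, JX⟩ = ⟨R(X, JS)JS, X⟩`.
  have hqJ : ∀ X, G (A (J X)) (J X) =
      B (a X X) (a (J S) (J S)) - B (a X (J S)) (a X (J S)) := fun X ↦ by
    have k1 := H.kaehler (J X) S S (J X)
    have k2 := H.kaehler (J S) X (J X) S
    have k3 := H.form_symm (a S (J S)) (a X (J X))
    have k4 := H.form_symm (a X X) (a (J S) (J S))
    rw [hq]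
    simp only [H.J_J, map_neg, LinearMap.neg_apply, H.symm S X, H.symm (J S) X, H.symm S (J X),
      H.symm (J S) (J X), H.symm (J X) X, H.symm (J S) S] at k1 k2 ⊢
    linarith
  have hsum : ∀ X, G (A X) X + G (A (J X)) (J X) ≤ -(1 / 2) * (
      (G S X * B v (a S X) + G (J S) X * B v (a (J S) X)) +
      (G S (J X) * B v (a S (J X)) + G (J S) (J X) * B v (a (J S) (J X)))) := fun X ↦ by
    have h1 := hqJ X
    have h2 := hqJ (J X)
    have h3 : B (invariantPart J a X X) (invariantPart J a S S) = 0 := by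
      rw [hS, map_smul, H.form_symm, hv, smul_zero]
    have h4 := hq X
    have h5 := hq (J X)
    have m1 := H.metric_mul_le hvv hvf S X
    have m2 := H.metric_mul_le hvv hvf (J S) X
    have m3 := H.metric_mul_le hvv hvf S (J X)
    have m4 := H.metric_mul_le hvv hvf (J S) (J X)
    simp only [H.J_J, map_neg, LinearMap.neg_apply, neg_neg, H.symm X S, H.symm X (J S),
      H.symm (J X) S, H.symm (J X) (J S), invariantPart_apply, map_add, LinearMap.add_apply]
      at h1 h2 h3 h4 h5 m1 m2 m3 m4 ⊢
    linarith
  have t1 := he.trace_eq_sum A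
  have t2 := he'.trace_eq_sum A
  have s1 := he.sum_metric_mul (B v ∘ₗ a S) S
  have s2 := he.sum_metric_mul (B v ∘ₗ a (J S)) (J S)
  have s3 := he'.sum_metric_mul (B v ∘ₗ a S) S
  have s4 := he'.sum_metric_mul (B v ∘ₗ a (J S)) (J S)
  simp only [hee, LinearMap.comp_apply] at t2 s1 s2 s3 s4
  have h1 := Finset.sum_le_sum fun i (_ : i ∈ Finset.univ) ↦ hsum (e i)
  rw [← Finset.mul_sum, Finset.sum_add_distrib, Finset.sum_add_distrib, Finset.sum_add_distrib,
    Finset.sum_add_distrib, s1, s2, s3, s4, ← t1, ← t2] at h1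
  have h2 := hv S S
  rw [invariantPart_apply, map_add] at h2
  linarith

/-- The dimension of a complex subspace is even. -/
theorem exists_finrank_eq_two_mul [FiniteDimensional ℝ V] {J : V →ₗ[ℝ] V}
    (hJ : ∀ X, J (J X) = -X) (S : Submodule ℝ V) (hS : ∀ X ∈ S, J X ∈ S) :
    ∃ l, Module.finrank ℝ S = 2 * l := by
  let j : S →ₗ[ℝ] S := J.restrict hS
  have hj : j * j = (-1 : ℝ) • (1 : S →ₗ[ℝ] S) := by
    ext X
    simp [j, hJ]
  -- Since `j² = -1`, the sign `(-1) ^ dim` is the square of a real determinant.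
  have h1 : LinearMap.det j * LinearMap.det j = (-1) ^ Module.finrank ℝ S := by
    rw [← map_mul, hj, LinearMap.det_smul, map_one, mul_one]
  rcases Nat.even_or_odd (Module.finrank ℝ S) with h | h
  · obtain ⟨l, hl⟩ := h
    exact ⟨l, by omega⟩
  · rw [h.neg_one_pow] at h1
    nlinarith [mul_self_nonneg (LinearMap.det j)]

end SecondForm

/-! ### The Gauss equation -/

open Filter Topology

section Gauss

variable {E L : Type*} [NormedAddCommGroup E] [NormedSpace ℝ E]
  [NormedAddCommGroup L] [NormedSpace ℝ L]

/-- The field of bilinear forms induced by a map `F` and a bilinear form `Λ` on its target. -/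
def pullbackForm (Λ : L →L[ℝ] L →L[ℝ] ℝ) (F : E → L) (y : E) : E →L[ℝ] E →L[ℝ] ℝ :=
  Λ.bilinearComp (fderiv ℝ F y) (fderiv ℝ F y)

@[simp]
theorem pullbackForm_apply (Λ : L →L[ℝ] L →L[ℝ] ℝ) (F : E → L) (y u v : E) :
    pullbackForm Λ F y u v = Λ (fderiv ℝ F y u) (fderiv ℝ F y v) := rfl

theorem contDiffAt_pullbackForm {Λ : L →L[ℝ] L →L[ℝ] ℝ} {F : E → L} {y : E} {m k : ℕ∞ω}
    (hF : ContDiffAt ℝ k F y) (hm : m + 1 ≤ k) : ContDiffAt ℝ m (pullbackForm Λ F) y := by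
  have h := hF.fderiv_right hm
  have h2 : pullbackForm Λ F = fun z ↦ ((ContinuousLinearMap.compL ℝ E L ℝ).flip (fderiv ℝ F z)) ∘L
      (Λ ∘L fderiv ℝ F z) := by
    ext z u v
    rfl
  rw [h2]
  fun_prop

theorem fderiv_pullbackForm {Λ : L →L[ℝ] L →L[ℝ] ℝ} {F : E → L} {y : E}
    (hF : ContDiffAt ℝ 2 F y) (u v w : E) : fderiv ℝ (pullbackForm Λ F) y u v w =
      Λ (fderiv ℝ (fderiv ℝ F) y u v) (fderiv ℝ F y w) +
        Λ (fderiv ℝ F y v) (fderiv ℝ (fderiv ℝ F) y u w) := by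
  have h0 : DifferentiableAt ℝ (pullbackForm Λ F) y :=
    (contDiffAt_pullbackForm (m := 1) hF (by norm_num)).differentiableAt (by simp)
  have h1 : DifferentiableAt ℝ (fderiv ℝ F) y :=
    (hF.fderiv_right (m := 1) (by norm_num)).differentiableAt (by simp)
  have h2 := ((h0.hasFDerivAt.clm_apply (hasFDerivAt_const v y)).clm_apply
    (hasFDerivAt_const w y))
  have h3 : HasFDerivAt (fun z ↦ pullbackForm Λ F z v w) _ y :=
    (Λ.hasFDerivAt.comp y (h1.hasFDerivAt.clm_apply (hasFDerivAt_const v y))).clm_apply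
      (h1.hasFDerivAt.clm_apply (hasFDerivAt_const w y))
  have := congrArg (fun T ↦ T u) (h2.unique h3)
  simpa [add_comm] using this

/-- The lowered Christoffel symbols of an induced metric. -/
theorem koszul_pullbackForm {Λ : L →L[ℝ] L →L[ℝ] ℝ} (hΛ : ∀ a b, Λ a b = Λ b a) {F : E → L} {y : E}
    (hF : ContDiffAt ℝ 2 F y) (u v w : E) : koszul (pullbackForm Λ F) y u v w =
      Λ (fderiv ℝ (fderiv ℝ F) y u v) (fderiv ℝ F y w) := by
  have hs : ∀ a b, fderiv ℝ (fderiv ℝ F) y a b = fderiv ℝ (fderiv ℝ F) y b a := fun a b ↦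
    (hF.isSymmSndFDerivAt (by simp)) a b
  simp only [koszul_apply, fderiv_pullbackForm hF, hs v u, hs w u, hs w v]
  rw [hΛ (fderiv ℝ F y v), hΛ (fderiv ℝ F y u) (fderiv ℝ (fderiv ℝ F) y v w)]
  ring

/-- The second fundamental form of a map `F` for the metric `G`: the Hessian of `F`. -/
def hessian (G : E → E →L[ℝ] E →L[ℝ] ℝ) (F : E → L) (y : E) : E →L[ℝ] E →L[ℝ] L :=
  fderiv ℝ (fderiv ℝ F) y - (ContinuousLinearMap.compL ℝ E E L (fderiv ℝ F y)) ∘L christoffel G y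

@[simp]
theorem hessian_apply (G : E → E →L[ℝ] E →L[ℝ] ℝ) (F : E → L) (y u v : E) :
    hessian G F y u v = fderiv ℝ (fderiv ℝ F) y u v - fderiv ℝ F y (christoffel G y u v) := rfl

theorem koszul_congr {G G' : E → E →L[ℝ] E →L[ℝ] ℝ} {y : E} (h : G =ᶠ[𝓝 y] G') :
    koszul G y = koszul G' y := by
  ext u v w
  simp only [koszul_apply, h.fderiv_eq]

theorem isInvertible_of_pos [FiniteDimensional ℝ E] {T : E →L[ℝ] E →L[ℝ] ℝ}
    (hT : ∀ u, u ≠ 0 → 0 < T u u) : T.IsInvertible := by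
  have hinj : Function.Injective T := by
    refine (injective_iff_map_eq_zero T).2 fun u hu ↦ ?_
    by_contra h
    simpa [hu] using hT u h
  have hdim : Module.finrank ℝ E = Module.finrank ℝ (E →L[ℝ] ℝ) := by
    rw [← LinearEquiv.finrank_eq (LinearMap.toContinuousLinearMap (𝕜 := ℝ) (E := E) (F' := ℝ))]
    exact Subspace.dual_finrank_eq.symm
  refine ⟨(LinearEquiv.ofInjectiveOfFinrankEq (T : E →ₗ[ℝ] E →L[ℝ] ℝ) hinj
    hdim).toContinuousLinearEquiv, ?_⟩
  ext u v
  rfl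

theorem apply_christoffel {G : E → E →L[ℝ] E →L[ℝ] ℝ} {y : E} (hG : (G y).IsInvertible)
    (u v w : E) : G y (christoffel G y u v) w = koszul G y u v w := by
  rw [christoffel_apply, hG.self_apply_inverse]

theorem contDiffAt_christoffel [FiniteDimensional ℝ E]
    {G : E → E →L[ℝ] E →L[ℝ] ℝ} {y : E} {m k : ℕ∞ω}
    (hG : ContDiffAt ℝ k G y) (hinv : (G y).IsInvertible) (hm : m + 1 ≤ k) :
    ContDiffAt ℝ m (christoffel G) y := by
  have h1 : ContDiffAt ℝ m (fderiv ℝ G) y := hG.fderiv_right hm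
  have h2 : ContDiffAt ℝ m (fun z ↦ (G z).inverse) y :=
    (hinv.contDiffAt_map_inverse).comp y (hG.of_le (le_self_add.trans hm))
  have h3 : ContDiffAt ℝ m (koszul G) y := by
    have h4 : ContDiffAt ℝ m (fun z ↦ (fderiv ℝ G z).flip) y :=
      (ContinuousLinearMap.flipₗᵢ ℝ E E
        (E →L[ℝ] ℝ)).toContinuousLinearEquiv.contDiff.contDiffAt.comp y h1
    exact ((h1.add h4).sub (contDiffAt_const.clm_comp h4)).const_smul (1 / 2 : ℝ)
  unfold christoffel
  fun_prop

variable {Λ : L →L[ℝ] L →L[ℝ] ℝ} {F : E → L} {G : E → E →L[ℝ] E →L[ℝ] ℝ} {y : E}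

/-- The local situation of an immersion: `G` is the metric induced by `F`. -/
structure IsLocalImmersion (Λ : L →L[ℝ] L →L[ℝ] ℝ) (F : E → L) (G : E → E →L[ℝ] E →L[ℝ] ℝ)
    (y : E) : Prop where
  form_symm : ∀ a b, Λ a b = Λ b a
  contDiffAt : ContDiffAt ℝ 3 F y
  metric_eq : G =ᶠ[𝓝 y] pullbackForm Λ F
  metric_pos : ∀ u, u ≠ 0 → 0 < G y u u

namespace IsLocalImmersion

theorem isInvertible [FiniteDimensional ℝ E] (H : IsLocalImmersion Λ F G y) : (G y).IsInvertible :=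
  isInvertible_of_pos H.metric_pos

theorem metric_apply (H : IsLocalImmersion Λ F G y) (u v : E) :
    G y u v = Λ (fderiv ℝ F y u) (fderiv ℝ F y v) := by
  rw [H.metric_eq.eq_of_nhds, pullbackForm_apply]

theorem contDiffAt_metric (H : IsLocalImmersion Λ F G y) : ContDiffAt ℝ 2 G y :=
  (contDiffAt_pullbackForm H.contDiffAt (by norm_num)).congr_of_eventuallyEq H.metric_eq

theorem differentiableAt_christoffel [FiniteDimensional ℝ E] (H : IsLocalImmersion Λ F G y) :
    DifferentiableAt ℝ (christoffel G) y :=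
  (contDiffAt_christoffel (m := 1) H.contDiffAt_metric H.isInvertible
    (by norm_num)).differentiableAt (by simp)

/-- Stated on a neighbourhood because the Gauss equation comes from differentiating it. -/
theorem eventually_metric_christoffel [FiniteDimensional ℝ E] (H : IsLocalImmersion Λ F G y) :
    ∀ᶠ z in 𝓝 y, ∀ u v w,
    G z (christoffel G z u v) w = Λ (fderiv ℝ (fderiv ℝ F) z u v) (fderiv ℝ F z w) := by
  have h1 : ∀ᶠ z in 𝓝 y, (G z).IsInvertible := by
    have := H.contDiffAt_metric.continuousAt.eventually
      ((ContinuousLinearEquiv.isOpen (𝕜 := ℝ) (E := E) (F := E →L[ℝ] ℝ)).mem_nhds H.isInvertible)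
    exact this
  filter_upwards [h1, H.metric_eq.eventually_nhds, H.contDiffAt.eventually (by simp)]
    with z hz1 hz2 hz3 u v w
  rw [apply_christoffel hz1, koszul_congr hz2,
    koszul_pullbackForm H.form_symm (hz3.of_le (by norm_num))]

theorem metric_christoffel [FiniteDimensional ℝ E] (H : IsLocalImmersion Λ F G y) (u v w : E) :
    G y (christoffel G y u v) w = Λ (fderiv ℝ (fderiv ℝ F) y u v) (fderiv ℝ F y w) :=
  H.eventually_metric_christoffel.self_of_nhds u v w

theorem eq_of_metric_eq (H : IsLocalImmersion Λ F G y) {u v : E} (h : ∀ w, G y u w = G y v w) :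
    u = v := by
  by_contra huv
  have := H.metric_pos (u - v) (sub_ne_zero.2 huv)
  simp [h] at this

theorem fderiv_fderiv_symm (H : IsLocalImmersion Λ F G y) (u v : E) :
    fderiv ℝ (fderiv ℝ F) y u v = fderiv ℝ (fderiv ℝ F) y v u :=
  (H.contDiffAt.isSymmSndFDerivAt (by simp; norm_num)) u v

theorem hessian_symm [FiniteDimensional ℝ E] (H : IsLocalImmersion Λ F G y) (u v : E) :
    hessian G F y u v = hessian G F y v u := by
  have h : christoffel G y u v = christoffel G y v u := H.eq_of_metric_eq fun w ↦ by
    rw [H.metric_christoffel, H.metric_christoffel, H.fderiv_fderiv_symm]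
  rw [hessian_apply, hessian_apply, h, H.fderiv_fderiv_symm]

theorem hessian_normal [FiniteDimensional ℝ E] (H : IsLocalImmersion Λ F G y) (u v w : E) :
    Λ (hessian G F y u v) (fderiv ℝ F y w) = 0 := by
  rw [hessian_apply, map_sub, sub_apply, ← H.metric_christoffel,
    H.metric_apply, sub_self]

/-- The Gauss equation. -/
theorem gauss [FiniteDimensional ℝ E] (H : IsLocalImmersion Λ F G y) (u v w t : E) :
    G y (localCurvature G y u v w) t =
      Λ (hessian G F y v w) (hessian G F y u t) - Λ (hessian G F y u w) (hessian G F y v t) := by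
  have hF : ContDiffAt ℝ 2 (fderiv ℝ F) y := H.contDiffAt.fderiv_right (by norm_num)
  have hF1 : DifferentiableAt ℝ (fderiv ℝ F) y := hF.differentiableAt (by simp)
  have hF2 : DifferentiableAt ℝ (fderiv ℝ (fderiv ℝ F)) y :=
    (hF.fderiv_right (m := 1) (by norm_num)).differentiableAt (by simp)
  have hGd : DifferentiableAt ℝ G y := H.contDiffAt_metric.differentiableAt (by simp)
  -- The derivative of the identity for `G (Γ(v, w)) t` in the direction `u`. The third derivative
  -- of `F` is symmetric in `u` and `v`, so antisymmetrizing leaves the Hessian products.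
  have key : ∀ u v w t, G y (fderiv ℝ (christoffel G) y u v w + christoffel G y u
      (christoffel G y v w)) t = Λ (fderiv ℝ (fderiv ℝ (fderiv ℝ F)) y u v w) (fderiv ℝ F y t) +
        Λ (hessian G F y v w) (hessian G F y u t) := by
    intro u v w t
    have h1 := (hGd.hasFDerivAt.clm_apply ((H.differentiableAt_christoffel.hasFDerivAt.clm_apply
      (hasFDerivAt_const v y)).clm_apply (hasFDerivAt_const w y))).clm_apply (hasFDerivAt_const t y)
    have h2 := (Λ.hasFDerivAt.comp y ((hF2.hasFDerivAt.clm_apply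
      (hasFDerivAt_const v y)).clm_apply (hasFDerivAt_const w y))).clm_apply
      (hF1.hasFDerivAt.clm_apply (hasFDerivAt_const t y))
    have h3 := h1.congr_of_eventuallyEq (H.eventually_metric_christoffel.mono
      fun z hz ↦ (hz v w t).symm)
    have h4 := congrArg (fun T ↦ T u) (h3.unique h2)
    have h5 := fderiv_pullbackForm (Λ := Λ) (H.contDiffAt.of_le (m := 2) (by norm_num)) u
      (christoffel G y v w) t
    rw [← H.metric_eq.fderiv_eq] at h5
    have h6 : Λ (hessian G F y v w) (hessian G F y u t) =
        Λ (hessian G F y v w) (fderiv ℝ (fderiv ℝ F) y u t) := by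
      conv_lhs => rw [hessian_apply _ _ _ u t, map_sub, H.hessian_normal, sub_zero]
    simp only [add_apply, ContinuousLinearMap.comp_apply,
      ContinuousLinearMap.flip_apply, zero_apply, map_zero, zero_add,
      h5, Function.comp_apply] at h4
    rw [h6, map_add, add_apply, H.metric_christoffel, hessian_apply, map_sub,
      sub_apply]
    linarith
  have hs : fderiv ℝ (fderiv ℝ (fderiv ℝ F)) y u v = fderiv ℝ (fderiv ℝ (fderiv ℝ F)) y v u :=
    hF.isSymmSndFDerivAt (by simp) u v
  have e : localCurvature G y u v w = (fderiv ℝ (christoffel G) y u v w + christoffel G y u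
      (christoffel G y v w)) - (fderiv ℝ (christoffel G) y v u w + christoffel G y v
      (christoffel G y u w)) := by
    rw [localCurvature]
    abel
  rw [e, map_sub, sub_apply, key, key, hs]
  ring

/-- For a map into a level set of the form `Λ`, the second fundamental form has a component in the
direction of the position vector. -/
theorem hessian_apply_self [FiniteDimensional ℝ E] (H : IsLocalImmersion Λ F G y) {c : ℝ}
    (hc : ∀ᶠ z in 𝓝 y, Λ (F z) (F z) = c) :
    (∀ u, Λ (fderiv ℝ F y u) (F y) = 0) ∧ ∀ u v, Λ (hessian G F y u v) (F y) = -G y u v := by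
  have h1 : ∀ᶠ z in 𝓝 y, ∀ u, Λ (fderiv ℝ F z u) (F z) = 0 := by
    filter_upwards [hc.eventually_nhds, H.contDiffAt.eventually (by simp)] with z hz hFz u
    have hd := (hFz.differentiableAt (by simp)).hasFDerivAt
    have h2 := ((Λ.hasFDerivAt.comp z hd).clm_apply hd).congr_of_eventuallyEq
      (hz.mono fun _ h ↦ h.symm)
    have h3 := congrArg (fun T ↦ T u) (h2.unique (hasFDerivAt_const c z))
    simp only [add_apply, ContinuousLinearMap.comp_apply,
      ContinuousLinearMap.flip_apply, zero_apply, Function.comp_apply,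
      H.form_symm (F z)] at h3
    linarith
  refine ⟨h1.self_of_nhds, fun u v ↦ ?_⟩
  have hF1 : DifferentiableAt ℝ (fderiv ℝ F) y :=
    (H.contDiffAt.fderiv_right (m := 1) (by norm_num)).differentiableAt (by simp)
  have hd := (H.contDiffAt.differentiableAt (by simp)).hasFDerivAt
  have h2 := ((Λ.hasFDerivAt.comp y (hF1.hasFDerivAt.clm_apply (hasFDerivAt_const v y))).clm_apply
    hd).congr_of_eventuallyEq (h1.mono fun _ h ↦ (h v).symm)
  have h3 := congrArg (fun T ↦ T u) (h2.unique (hasFDerivAt_const 0 y))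
  simp only [add_apply, ContinuousLinearMap.comp_apply,
    ContinuousLinearMap.flip_apply, zero_apply, Function.comp_apply,
    map_zero, zero_add] at h3
  rw [hessian_apply, map_sub, sub_apply, h1.self_of_nhds, H.metric_apply,
    H.form_symm (fderiv ℝ F y u)]
  linarith

end IsLocalImmersion

/-- The curvature commutes with parallel fields of endomorphisms. -/
theorem localCurvature_parallel {J : E → E →L[ℝ] E} (hΓ : DifferentiableAt ℝ (christoffel G) y)
    (hJ : ContDiffAt ℝ 2 J y) (hpar : ∀ᶠ z in 𝓝 y, ∀ u v, localCovDerivEnd G J z u v = 0)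
    (u v w : E) : localCurvature G y u v (J y w) = J y (localCurvature G y u v w) := by
  have hJ1 := (hJ.differentiableAt (by simp)).hasFDerivAt
  have hJ2 : DifferentiableAt ℝ (fderiv ℝ J) y :=
    (hJ.fderiv_right (m := 1) (by norm_num)).differentiableAt (by simp)
  have hs : fderiv ℝ (fderiv ℝ J) y u v = fderiv ℝ (fderiv ℝ J) y v u :=
    hJ.isSymmSndFDerivAt (by simp) u v
  -- The derivative of `∇_v J = 0` in the direction `u`. Antisymmetrizing removes the second
  -- derivative of `J` and leaves the commutator of `J` with the curvature.
  have key : ∀ u v, fderiv ℝ (fderiv ℝ J) y u v w + (fderiv ℝ (christoffel G) y u v (J y w) +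
      christoffel G y v (fderiv ℝ J y u w)) - (fderiv ℝ J y u (christoffel G y v w) +
      J y (fderiv ℝ (christoffel G) y u v w)) = 0 := by
    intro u v
    have h1 := (((hJ2.hasFDerivAt.clm_apply (hasFDerivAt_const v y)).clm_apply
      (hasFDerivAt_const w y)).add ((hΓ.hasFDerivAt.clm_apply (hasFDerivAt_const v y)).clm_apply
      (hJ1.clm_apply (hasFDerivAt_const w y)))).sub (hJ1.clm_apply
      ((hΓ.hasFDerivAt.clm_apply (hasFDerivAt_const v y)).clm_apply (hasFDerivAt_const w y)))
    have h2 := h1.congr_of_eventuallyEq (hpar.mono fun z hz ↦ (hz v w).symm)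
    have h3 := congrArg (fun T ↦ T u) (h2.unique (hasFDerivAt_const 0 y))
    simp only [add_apply, sub_apply,
      ContinuousLinearMap.comp_apply, ContinuousLinearMap.flip_apply,
      zero_apply, map_zero, zero_add] at h3
    rw [← h3]
    abel
  have hD : ∀ u x, fderiv ℝ J y u x = J y (christoffel G y u x) - christoffel G y u (J y x) :=
    fun u x ↦ by
      have := hpar.self_of_nhds u x
      rw [localCovDerivEnd, sub_eq_zero] at this
      rw [← this, add_sub_cancel_right]
  have k1 := key u v
  have k2 := key v u
  simp only [hD, map_sub, hs] at k1 k2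
  rw [← sub_eq_zero]
  simp only [localCurvature, map_sub, map_add]
  rw [← sub_eq_zero.2 (k1.trans k2.symm)]
  abel

end Gauss

/-! ### The estimate in coordinates -/

section LocalEstimate

/-- The Lorentzian inner product as a continuous bilinear form. -/
def lorentzForm (N : ℕ) : LorentzSpace N →L[ℝ] LorentzSpace N →L[ℝ] ℝ :=
  let I : EuclideanSpace ℝ (Fin N) →L[ℝ] EuclideanSpace ℝ (Fin N) →L[ℝ] ℝ := innerSL ℝ
  let P₁ : LorentzSpace N →L[ℝ] ℝ := .fst ℝ ℝ (EuclideanSpace ℝ (Fin N))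
  let P₂ : LorentzSpace N →L[ℝ] EuclideanSpace ℝ (Fin N) := .snd ℝ ℝ (EuclideanSpace ℝ (Fin N))
  I.bilinearComp P₂ P₂ - (ContinuousLinearMap.mul ℝ ℝ).bilinearComp P₁ P₁

theorem lorentzForm_apply {N : ℕ} (a b : LorentzSpace N) : lorentzForm N a b = lorentz a b := rfl

theorem lorentz_comm {N : ℕ} (a b : LorentzSpace N) : lorentz a b = lorentz b a := by
  simp only [lorentz, real_inner_comm, mul_comm]

theorem lorentz_pos_of_orthogonal {N : ℕ} {a w : LorentzSpace N} (ha : lorentz a a = -1)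
    (hw : lorentz w a = 0) (h0 : w ≠ 0) : 0 < lorentz w w := by
  obtain ⟨t, x⟩ := a
  obtain ⟨s, z⟩ := w
  simp only [lorentz, real_inner_self_eq_norm_sq] at *
  have hcs := real_inner_mul_inner_self_le z x
  simp only [real_inner_self_eq_norm_sq] at hcs
  have h1 : inner ℝ z x = s * t := by linarith
  have h2 : ‖x‖ ^ 2 = t * t - 1 := by linarith
  rw [h1, h2] at hcs
  have ht : 1 ≤ t * t := by nlinarith [sq_nonneg ‖x‖]
  by_contra hneg
  have hz : ‖z‖ ^ 2 = 0 := by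
    have h3 : t * t * ‖z‖ ^ 2 ≤ t * t * (s * s) :=
      mul_le_mul_of_nonneg_left (by linarith) (by linarith)
    nlinarith [sq_nonneg ‖z‖]
  have hs : s = 0 := by
    rw [hz] at hcs
    have : s * s ≤ s * s * (t * t) := le_mul_of_one_le_right (mul_self_nonneg s) ht
    nlinarith [mul_self_nonneg s]
  apply h0
  have : z = 0 := by simpa using hz
  rw [hs, this]
  rfl

theorem finrank_lorentzSpace (N : ℕ) : Module.finrank ℝ (LorentzSpace N) = N + 1 := by
  rw [Module.finrank_prod, Module.finrank_self, finrank_euclideanSpace_fin, add_comm]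

theorem IsLocalImmersion.exists_complex_subspace {n p : ℕ} (hpn : p + 2 ≤ n)
    {F : Model n → LorentzSpace (2 * n + p)} {G : Model n → Model n →L[ℝ] Model n →L[ℝ] ℝ}
    {y : Model n} (H : IsLocalImmersion (lorentzForm (2 * n + p)) F G y)
    (hF : ∀ᶠ z in 𝓝 y, lorentz (F z) (F z) = -1) {J : Model n → Model n →L[ℝ] Model n}
    (hJ : ContDiffAt ℝ 2 J y) (hpar : ∀ᶠ z in 𝓝 y, ∀ u v, localCovDerivEnd G J z u v = 0)
    (hJJ : ∀ u, J y (J y u) = -u) (hGJ : ∀ u v, G y (J y u) (J y v) = G y u v) :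
    ∃ S : Submodule ℝ (Model n), (∀ X ∈ S, J y X ∈ S) ∧ 2 * (n - p + 1) ≤ Module.finrank ℝ S ∧
      ∀ X ∈ S, G y (localCurvature G y X (J y X) (J y X)) X ≤ 0 ∧
        ∀ A : Model n →ₗ[ℝ] Model n, (∀ Z, A Z = localCurvature G y Z X X) →
          LinearMap.trace ℝ (Model n) A ≤ 0 := by
  obtain ⟨hDF, hhess⟩ := H.hessian_apply_self (c := -1) hF
  have hFy : lorentz (F y) (F y) = -1 := hF.self_of_nhds
  have hGs : ∀ u v, G y u v = G y v u := fun u v ↦ by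
    rw [H.metric_apply, H.metric_apply, H.form_symm]
  let Λ : LinearMap.BilinForm ℝ (LorentzSpace (2 * n + p)) :=
    (lorentzForm (2 * n + p)).toLinearMap₁₂
  have hΛ : ∀ a b, Λ a b = lorentz a b := fun a b ↦ rfl
  have hΛr : Λ.IsSymm := ⟨fun a b ↦ lorentz_comm a b⟩
  have hΛn : Λ.Nondegenerate := by
    refine (LinearMap.IsRefl.nondegenerate_iff_separatingLeft hΛr.isRefl).2 fun a ha ↦ ?_
    by_contra h0
    exact (lorentz_pos_of_orthogonal hFy (ha (F y)) h0).ne' (ha a)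
  let T : Submodule ℝ (LorentzSpace (2 * n + p)) := LinearMap.range (fderiv ℝ F y).toLinearMap
  let W := Λ.orthogonal T
  have hmem : ∀ w : LorentzSpace (2 * n + p),
      w ∈ W ↔ ∀ u, lorentzForm (2 * n + p) w (fderiv ℝ F y u) = 0 := by
    intro w
    constructor
    · intro hw u
      rw [H.form_symm]
      exact hw _ ⟨u, rfl⟩
    · rintro hw _ ⟨u, rfl⟩
      exact (H.form_symm _ _).trans (hw u)
  have hW : Module.finrank ℝ W = p + 1 := by
    have h1 := Λ.finrank_orthogonal hΛn T
    have h2 : Module.finrank ℝ T = 2 * n := by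
      rw [LinearMap.finrank_range_of_inj, finrank_euclideanSpace_fin]
      refine (injective_iff_map_eq_zero _).2 fun u hu ↦ ?_
      by_contra h0
      have hu' : fderiv ℝ F y u = 0 := hu
      have := H.metric_pos u h0
      simp [H.metric_apply, hu'] at this
    rw [h2, finrank_lorentzSpace] at h1
    change Module.finrank ℝ W = _ at h1
    omega
  let B : LinearMap.BilinForm ℝ W := Λ.restrict W
  let f : W := ⟨F y, (hmem _).2 fun u ↦ (H.form_symm _ _).trans (hDF u)⟩
  let a : Model n →ₗ[ℝ] Model n →ₗ[ℝ] W := LinearMap.mk₂ ℝ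
    (fun u v ↦ ⟨hessian G F y u v, (hmem _).2 (H.hessian_normal u v)⟩)
    (fun _ _ _ ↦ Subtype.ext (by simp only [map_add, add_apply, Submodule.coe_add]))
    (fun _ _ _ ↦ Subtype.ext (by simp only [map_smul, smul_apply, Submodule.coe_smul]))
    (fun _ _ _ ↦ Subtype.ext (by simp only [map_add, Submodule.coe_add]))
    (fun _ _ _ ↦ Subtype.ext (by simp only [map_smul, Submodule.coe_smul]))
  have hBa : ∀ u v u' v', B (a u v) (a u' v') =
      lorentzForm (2 * n + p) (hessian G F y u v) (hessian G F y u' v') := fun _ _ _ _ ↦ rfl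
  have hgauss : ∀ u v w t, G y (localCurvature G y u v w) t =
      B (a u t) (a v w) - B (a u w) (a v t) := fun u v w t ↦ by
    rw [H.gauss, hBa, hBa, H.form_symm (hessian G F y v w)]
  let G₀ : LinearMap.BilinForm ℝ (Model n) := (G y).toLinearMap₁₂
  have hG₀ : ∀ u v, G₀ u v = G y u v := fun _ _ ↦ rfl
  have HK : IsKaehlerSecondForm (J y).toLinearMap G₀ B f a :=
    { J_J := hJJ
      metric_symm := hGs
      metric_pos := H.metric_pos
      metric_J := hGJ
      form_symm := fun v w ↦ lorentz_comm v.1 w.1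
      form_self := hFy
      form_pos := fun w hw h0 ↦ lorentz_pos_of_orthogonal hFy hw (by simpa using h0)
      symm := fun u v ↦ Subtype.ext (H.hessian_symm u v)
      apply_f := hhess
      kaehler := fun u v w t ↦ by
        have hp := localCurvature_parallel H.differentiableAt_christoffel hJ hpar u v w
        have h1 := hgauss u v (J y w) (J y t)
        rw [hp, hGJ, hgauss] at h1
        exact h1.symm }
  -- Here `dim W = p + 1`, so the dimension condition is `2 (p + 1) < 2 n`, that is `p + 2 ≤ n`; the
  -- codimension is at most `2 (p + 1) - 4 = 2 (p - 1)`.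
  obtain ⟨v, S, hvv, hvf, hv, hSJ, hS, hSa⟩ := HK.exists_subspace
    (by rw [hW, finrank_euclideanSpace_fin]; omega)
  rw [hW, finrank_euclideanSpace_fin] at hS
  refine ⟨S, hSJ, by omega, fun X hX ↦ ⟨?_, fun A hA ↦ ?_⟩⟩
  · rw [hgauss]
    exact HK.sectional_nonpos hvv hvf (hSa X hX)
  · exact HK.trace_nonpos hvv hvf hv (hSa X hX) A fun Z t ↦ by rw [hG₀, hA, hgauss]

end LocalEstimate

/-! ### Passage to the preferred chart and the estimate -/

section Chart

variable {n : ℕ} {M : Type*} [TopologicalSpace M] [ChartedSpace (Model n) M]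

theorem extChartAt_target_mem_nhds_self (x : M) :
    (extChartAt 𝓘(ℝ, Model n) x).target ∈ 𝓝 (extChartAt 𝓘(ℝ, Model n) x x) :=
  (isOpen_extChartAt_target x).mem_nhds (mem_extChartAt_target x)

theorem chartSymmDeriv_eq_mfderivWithin (x₀ : M) (y : Model n) :
    chartSymmDeriv x₀ y = mfderivWithin 𝓘(ℝ, Model n) 𝓘(ℝ, Model n)
      (extChartAt 𝓘(ℝ, Model n) x₀).symm (Set.range 𝓘(ℝ, Model n)) y := by
  rw [chartSymmDeriv, ← mfderivWithin_univ, modelWithCornersSelf_coe, Set.range_id]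

variable [IsManifold 𝓘(ℝ, Model n) ∞ M]

theorem chartSymmDeriv_self (x : M) (u : Model n) :
    (chartSymmDeriv x (extChartAt 𝓘(ℝ, Model n) x x) u : Model n) = u := by
  rw [chartSymmDeriv_eq_mfderivWithin]
  have : IsManifold 𝓘(ℝ, Model n) 1 M := .of_le (n := ∞) (by simp)
  exact congrArg (fun T : Model n →L[ℝ] Model n ↦ T u)
    (mfderivWithin_range_extChartAt_symm (I := 𝓘(ℝ, Model n)) (x := x))

theorem chartMetric_self (g : RiemannianMetric n M) (x : M) (u v : Model n) :
    chartMetric g x (extChartAt 𝓘(ℝ, Model n) x x) u v = g.inner x u v := by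
  -- The base point `(extChartAt _ x).symm (extChartAt _ x x)` is only propositionally `x`, so it is
  -- generalized before substitution.
  have key : ∀ x' (a b : Model n), x' = x → a = u → b = v →
      (g.inner x' : Model n →L[ℝ] Model n →L[ℝ] ℝ) a b = g.inner x u v := by
    rintro _ _ _ rfl rfl rfl
    rfl
  exact key _ _ _ (extChartAt_to_inv x) (chartSymmDeriv_self x u) (chartSymmDeriv_self x v)

theorem chartEnd_self
    (J : ∀ x : M, TangentSpace 𝓘(ℝ, Model n) x →L[ℝ] TangentSpace 𝓘(ℝ, Model n) x)
    (x : M) (u : Model n) :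
    chartEnd J x (extChartAt 𝓘(ℝ, Model n) x x) u = J x u := by
  have : IsManifold 𝓘(ℝ, Model n) 1 M := .of_le (n := ∞) (by simp)
  have h1 : ∀ x', x' = x → ∀ w : Model n,
      (mfderiv 𝓘(ℝ, Model n) 𝓘(ℝ, Model n) (extChartAt 𝓘(ℝ, Model n) x) x' :
        Model n →L[ℝ] Model n) w = w := by
    rintro _ rfl w
    exact congrArg (fun T : Model n →L[ℝ] Model n ↦ T w)
      (mfderiv_extChartAt_self (I := 𝓘(ℝ, Model n)))
  have h2 : ∀ x' (a : Model n), x' = x → a = u →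
      (J x' : Model n →L[ℝ] Model n) a = J x u := by
    rintro _ _ rfl rfl
    rfl
  exact (h1 _ (extChartAt_to_inv x) _).trans
    (h2 _ _ (extChartAt_to_inv x) (chartSymmDeriv_self x u))

theorem contDiffAt_chartEnd (K : KaehlerStructure n M) (x : M) :
    ContDiffAt ℝ ∞ (chartEnd K.J x) (extChartAt 𝓘(ℝ, Model n) x x) := by
  have : IsManifold 𝓘(ℝ, Model n) 1 M := .of_le (n := ∞) (by simp)
  have h1 := ((contMDiffAt_hom_bundle _).1 (K.contMDiff_J x)).2
  have h2 : ContMDiffAt 𝓘(ℝ, Model n) 𝓘(ℝ, Model n) ∞ (extChartAt 𝓘(ℝ, Model n) x).symm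
      (extChartAt 𝓘(ℝ, Model n) x x) :=
    (contMDiffOn_extChartAt_symm x).contMDiffAt (extChartAt_target_mem_nhds_self x)
  have h3 := ContMDiffAt.comp_of_eq h1 h2 (extChartAt_to_inv x)
  refine (contMDiffAt_iff_contDiffAt.1 h3).congr_of_eventuallyEq ?_
  filter_upwards [extChartAt_target_mem_nhds_self x] with z hz
  have hz' : (extChartAt 𝓘(ℝ, Model n) x).symm z ∈ (chartAt (Model n) x).source := by
    rw [← extChartAt_source 𝓘(ℝ, Model n)]
    exact (extChartAt 𝓘(ℝ, Model n) x).map_target hz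
  simp only [Function.comp_apply, ContinuousLinearMap.inCoordinates]
  rw [TangentBundle.continuousLinearMapAt_trivializationAt hz',
    TangentBundle.symmL_trivializationAt hz', (extChartAt 𝓘(ℝ, Model n) x).right_inv hz]
  rw [chartEnd, chartSymmDeriv_eq_mfderivWithin, chartDeriv]

variable {N : ℕ}

/-- In the preferred chart an isometric immersion induces the metric. -/
theorem IsIsometricImmersion.isLocalImmersion {g : RiemannianMetric n M} {f : M → HyperbolicSpace N}
    (hf : IsIsometricImmersion g f) (x : M) :
    IsLocalImmersion (lorentzForm N)
      (fun z ↦ (f ((extChartAt 𝓘(ℝ, Model n) x).symm z)).incl) (chartMetric g x)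
      (extChartAt 𝓘(ℝ, Model n) x x) where
  form_symm := lorentz_comm
  contDiffAt := by
    have h2 : ContMDiffAt 𝓘(ℝ, Model n) 𝓘(ℝ, Model n) ∞ (extChartAt 𝓘(ℝ, Model n) x).symm
        (extChartAt 𝓘(ℝ, Model n) x x) :=
      (contMDiffOn_extChartAt_symm x).contMDiffAt (extChartAt_target_mem_nhds_self x)
    exact (contMDiffAt_iff_contDiffAt.1 ((hf.contMDiff _).comp _ h2)).of_le
      (WithTop.coe_le_coe.2 (le_top (a := 3)))
  metric_eq := by
    filter_upwards [extChartAt_target_mem_nhds_self x] with z hz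
    have h2 : MDifferentiableAt 𝓘(ℝ, Model n) 𝓘(ℝ, Model n)
        (extChartAt 𝓘(ℝ, Model n) x).symm z :=
      ((contMDiffOn_extChartAt_symm (n := ∞) x).contMDiffAt
        ((isOpen_extChartAt_target x).mem_nhds hz)).mdifferentiableAt (by simp)
    have h3 : fderiv ℝ (fun z ↦ (f ((extChartAt 𝓘(ℝ, Model n) x).symm z)).incl) z =
        (mfderiv 𝓘(ℝ, Model n) 𝓘(ℝ, LorentzSpace N) (fun x ↦ (f x).incl)
          ((extChartAt 𝓘(ℝ, Model n) x).symm z)).comp (chartSymmDeriv x z) := by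
      rw [← mfderiv_eq_fderiv]
      exact mfderiv_comp z ((hf.contMDiff _).mdifferentiableAt (by simp)) h2
    ext u v
    rw [pullbackForm_apply, h3, lorentzForm_apply]
    exact (hf.isometric _ _ _).symm
  metric_pos u hu := by
    rw [chartMetric_self]
    exact g.pos x u hu

theorem IsIsometricImmersion.exists_complex_subspace {p : ℕ} (hpn : p + 2 ≤ n)
    (K : KaehlerStructure n M) {f : M → HyperbolicSpace (2 * n + p)}
    (hf : IsIsometricImmersion K.metric f) (x : M) :
    ∃ (ℓ : ℕ) (V : Submodule ℝ (TangentSpace 𝓘(ℝ, Model n) x)),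
      n - p + 1 ≤ ℓ ∧ K.IsComplexSubspace x V ℓ ∧
      ∀ S ∈ V, (S ≠ 0 → sectionalCurvature K.metric x S (K.J x S) ≤ 0) ∧
        ricci K.metric x S ≤ 0 := by
  let Jx : Model n →L[ℝ] Model n := K.J x
  let gx : Model n →L[ℝ] Model n →L[ℝ] ℝ := K.metric.inner x
  have hJx : chartEnd K.J x (extChartAt 𝓘(ℝ, Model n) x x) = Jx :=
    ContinuousLinearMap.ext (chartEnd_self K.J x)
  have hGx : chartMetric K.metric x (extChartAt 𝓘(ℝ, Model n) x x) = gx :=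
    ContinuousLinearMap.ext fun u ↦ ContinuousLinearMap.ext (chartMetric_self K.metric x u)
  obtain ⟨V, hVJ, hV, hVc⟩ := (hf.isLocalImmersion x).exists_complex_subspace hpn
    (Eventually.of_forall fun z ↦ (f _).2.1)
    ((contDiffAt_chartEnd K x).of_le (WithTop.coe_le_coe.2 (le_top (a := 2))))
    (by filter_upwards [extChartAt_target_mem_nhds_self x] with z hz using K.parallel_J x z hz)
    (fun u ↦ by rw [hJx]; exact K.J_J x u)
    (fun u v ↦ by rw [hJx, hGx]; exact K.inner_J_J x u v)
  rw [hJx] at hVJ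
  rw [hJx, hGx] at hVc
  obtain ⟨ℓ, hℓ⟩ := exists_finrank_eq_two_mul (J := Jx.toLinearMap) (K.J_J x) V hVJ
  refine ⟨ℓ, V, by omega, ⟨hVJ, hℓ⟩, fun S hS ↦ ⟨fun _ ↦ ?_, ?_⟩⟩
  -- Since `S ⊥ J S`, the denominator is the square of `g(S, S)`.
  · refine div_nonpos_of_nonpos_of_nonneg (hVc S hS).1 ?_
    have h1 : K.metric.inner x S (K.J x S) = 0 := by
      have := K.inner_J_J x S (K.J x S)
      rw [K.J_J, map_neg, K.metric.symm] at this
      linarith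
    rw [h1, K.inner_J_J]
    nlinarith [mul_self_nonneg (K.metric.inner x S S)]
  · exact (hVc S hS).2 (curvatureOperator K.metric x S S) fun Z ↦ rfl

end Chart

/-! ### Products of spheres and planes in a horosphere -/

namespace SphereProduct

variable {n : ℕ}

/-- The coordinates of `Model n`, as pairs of coordinates of the `n` factors. -/
def idx (s : Fin 2) (i : Fin n) : Fin (2 * n) := finProdFinEquiv (s, i)

/-- The factor to which a coordinate belongs. -/
def factor (j : Fin (2 * n)) : Fin n := (finProdFinEquiv.symm j).2

/-- The position of a coordinate in its factor. -/
def side (j : Fin (2 * n)) : Fin 2 := (finProdFinEquiv.symm j).1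

@[simp]
theorem side_idx (s : Fin 2) (i : Fin n) : side (idx s i) = s := by simp [side, idx]

@[simp]
theorem factor_idx (s : Fin 2) (i : Fin n) : factor (idx s i) = i := by simp [factor, idx]

theorem idx_inj {s s' : Fin 2} {i i' : Fin n} : idx s i = idx s' i' ↔ s = s' ∧ i = i' := by
  simp [idx]

theorem forall_idx {P : Fin (2 * n) → Prop} (h₀ : ∀ i, P (idx 0 i)) (h₁ : ∀ i, P (idx 1 i))
    (j : Fin (2 * n)) : P j := by
  obtain ⟨⟨s, i⟩, rfl⟩ := finProdFinEquiv.surjective j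
  fin_cases s
  exacts [h₀ i, h₁ i]

theorem sum_idx (φ : Fin (2 * n) → ℝ) : ∑ j, φ j = ∑ i : Fin n, (φ (idx 0 i) + φ (idx 1 i)) := by
  rw [← finProdFinEquiv.sum_comp, Fintype.sum_prod_type, Fin.sum_univ_two,
    ← Finset.sum_add_distrib]
  rfl

/-- The inner product of the components of two vectors in the `i`-th factor. -/
def dot (i : Fin n) : Model n →L[ℝ] Model n →L[ℝ] ℝ :=
  let P (s : Fin 2) : Model n →L[ℝ] ℝ := EuclideanSpace.proj (idx s i)
  (P 0).smulRight (P 0) + (P 1).smulRight (P 1)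

theorem dot_apply (i : Fin n) (u v : Model n) :
    dot i u v = u (idx 0 i) * v (idx 0 i) + u (idx 1 i) * v (idx 1 i) := rfl

theorem dot_comm (i : Fin n) (u v : Model n) : dot i u v = dot i v u := by
  simp only [dot_apply]
  ring

theorem dot_self_nonneg (i : Fin n) (u : Model n) : 0 ≤ dot i u u := by
  exact add_nonneg (mul_self_nonneg _) (mul_self_nonneg _)

theorem sum_dot (u v : Model n) : ∑ i, dot i u v = inner ℝ u v := by
  rw [PiLp.inner_apply, sum_idx]
  simp [dot_apply, mul_comm]

/-- The complex structure, rotating each factor by a right angle. -/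
def rot : Model n →L[ℝ] Model n := LinearMap.toContinuousLinearMap
  { toFun := fun u ↦ WithLp.toLp 2 fun j ↦
      if side j = 0 then -u (idx 1 (factor j)) else u (idx 0 (factor j))
    map_add' := fun u v ↦ by
      ext j
      simp only [PiLp.add_apply]
      split_ifs <;> ring
    map_smul' := fun a u ↦ by
      ext j
      simp only [PiLp.smul_apply, smul_eq_mul, RingHom.id_apply]
      split_ifs <;> ring }

@[simp]
theorem rot_idx_zero (u : Model n) (i : Fin n) : rot u (idx 0 i) = -u (idx 1 i) := by
  simp [rot]

@[simp]
theorem rot_idx_one (u : Model n) (i : Fin n) : rot u (idx 1 i) = u (idx 0 i) := by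
  simp [rot]

theorem rot_rot (u : Model n) : rot (rot u) = -u := by
  ext j
  revert j
  apply forall_idx <;> simp

theorem dot_rot_rot (i : Fin n) (u v : Model n) : dot i (rot u) (rot v) = dot i u v := by
  simp only [dot_apply, rot_idx_zero, rot_idx_one]
  ring

theorem dot_rot_self (i : Fin n) (u : Model n) : dot i u (rot u) = 0 := by
  simp only [dot_apply, rot_idx_zero, rot_idx_one]
  ring

/-- The curvatures of the factors: the first `m` are unit spheres, the others are flat. -/
def curv (m : ℕ) (i : Fin n) : ℝ := if (i : ℕ) < m then 1 else 0

theorem curv_nonneg (m : ℕ) (i : Fin n) : 0 ≤ curv m i := by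
  unfold curv
  split_ifs <;> norm_num

theorem sum_curv_mul {m : ℕ} (hm : m ≤ n) (φ : Fin n → ℝ) :
    ∑ i, curv m i * φ i = ∑ k : Fin m, φ (Fin.castLE hm k) := by
  simp only [curv, ite_mul, one_mul, zero_mul]
  rw [← Finset.sum_filter]
  symm
  refine Finset.sum_bij (fun k _ ↦ Fin.castLE hm k) (by simp) (by simp) (fun i hi ↦ ?_) (by simp)
  simp only [Finset.mem_filter, Finset.mem_univ, true_and] at hi
  exact ⟨⟨i, hi⟩, Finset.mem_univ _, rfl⟩

/-- The inverse square root of the conformal factor of the metric of the `i`-th factor. -/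
def den (m : ℕ) (y : Model n) (i : Fin n) : ℝ := 1 + curv m i * dot i y y / 4

theorem den_pos (m : ℕ) (y : Model n) (i : Fin n) : 0 < den m y i := by
  have := mul_nonneg (curv_nonneg m i) (dot_self_nonneg i y)
  unfold den
  linarith

theorem contDiff_den (m : ℕ) (i : Fin n) {k : ℕ∞ω} :
    ContDiff ℝ k (fun y : Model n ↦ den m y i) := by
  unfold den
  fun_prop

theorem den_zero (m : ℕ) (i : Fin n) : den m 0 i = 1 := by simp [den]

theorem hasDerivAt_den (m : ℕ) (y u : Model n) (i : Fin n) :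
    HasDerivAt (fun t : ℝ ↦ den m (y + t • u) i) (curv m i * dot i y u / 2) 0 := by
  have h1 : ∀ t : ℝ, den m (y + t • u) i =
      den m y i + t * (curv m i * dot i y u / 2) + t ^ 2 * (curv m i * dot i u u / 4) := fun t ↦ by
    simp only [den, map_add, map_smul, add_apply, smul_apply, smul_eq_mul, dot_comm i u y]
    ring
  simp only [h1]
  have h2 := (((hasDerivAt_id (0 : ℝ)).mul_const (curv m i * dot i y u / 2)).const_add
    (den m y i)).fun_add (((hasDerivAt_id (0 : ℝ)).pow 2).mul_const (curv m i * dot i u u / 4))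
  simpa using h2

/-! #### The metric -/

/-- The product metric. -/
def metricForm (m : ℕ) (y : Model n) : Model n →L[ℝ] Model n →L[ℝ] ℝ :=
  ∑ i, ((den m y i) ^ 2)⁻¹ • dot i

theorem metricForm_apply (m : ℕ) (y u v : Model n) :
    metricForm m y u v = ∑ i, ((den m y i) ^ 2)⁻¹ * dot i u v := by
  simp [metricForm, sum_apply]

theorem metricForm_zero (m : ℕ) (u v : Model n) :
    metricForm m 0 u v = ∑ i, dot i u v := by
  simp [metricForm_apply, den_zero]

theorem contDiff_metricForm (m : ℕ) {k : ℕ∞ω} : ContDiff ℝ k (metricForm (n := n) m) := by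
  unfold metricForm
  refine ContDiff.sum fun i _ ↦ ContDiff.fun_smul ?_ contDiff_const
  exact ((contDiff_den m i).pow 2).inv fun y ↦ (pow_pos (den_pos m y i) 2).ne'

theorem metricForm_symm (m : ℕ) (y u v : Model n) : metricForm m y u v = metricForm m y v u := by
  simp only [metricForm_apply, dot_comm _ u v]

theorem metricForm_rot (m : ℕ) (y u v : Model n) :
    metricForm m y (rot u) (rot v) = metricForm m y u v := by
  simp only [metricForm_apply, dot_rot_rot]

/-- Each conformal denominator is at most `1 + ‖y‖² / 4`, as the curvatures are at most `1`. The
bound yields both positivity of the metric and boundedness of its unit balls. -/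
theorem norm_sq_le_metricForm (m : ℕ) (y u : Model n) :
    ‖u‖ ^ 2 ≤ (1 + ‖y‖ ^ 2 / 4) ^ 2 * metricForm m y u u := by
  rw [← real_inner_self_eq_norm_sq u, ← sum_dot, metricForm_apply, Finset.mul_sum]
  refine Finset.sum_le_sum fun i _ ↦ ?_
  have h1 : den m y i ≤ 1 + ‖y‖ ^ 2 / 4 := by
    have h2 : dot i y y ≤ ‖y‖ ^ 2 := by
      rw [← real_inner_self_eq_norm_sq y, ← sum_dot]
      exact Finset.single_le_sum (f := fun i ↦ dot i y y) (fun j _ ↦ dot_self_nonneg j y)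
        (Finset.mem_univ i)
    have h3 : curv m i * dot i y y ≤ dot i y y := by
      have : curv m i ≤ 1 := by unfold curv; split_ifs <;> norm_num
      exact mul_le_of_le_one_left (dot_self_nonneg i y) this
    unfold den
    linarith
  have h4 := pow_le_pow_left₀ (den_pos m y i).le h1 2
  have h5 := pow_pos (den_pos m y i) 2
  rw [← mul_assoc, ← div_eq_mul_inv]
  exact le_mul_of_one_le_left (dot_self_nonneg i u) ((one_le_div h5).2 h4)

theorem metricForm_pos (m : ℕ) (y u : Model n) (hu : u ≠ 0) : 0 < metricForm m y u u := by
  have h1 := norm_sq_le_metricForm m y u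
  have h2 : 0 < ‖u‖ ^ 2 := pow_pos (norm_pos_iff.2 hu) 2
  exact pos_of_mul_pos_right (h2.trans_le h1) (by positivity)

theorem hasDerivAt_line (y u : Model n) : HasDerivAt (fun t : ℝ ↦ y + t • u) u 0 := by
  simpa using ((hasDerivAt_id (0 : ℝ)).smul_const u).const_add y

theorem fderiv_metricForm (m : ℕ) (y u v w : Model n) :
    fderiv ℝ (metricForm m) y u v w =
      ∑ i, -(curv m i / den m y i ^ 3) * (dot i y u * dot i v w) := by
  have h1 : HasFDerivAt (metricForm m) (fderiv ℝ (metricForm m) y) (y + (0 : ℝ) • u) := by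
    rw [zero_smul, add_zero]
    exact ((contDiff_metricForm (k := 1) m).differentiable (by simp) y).hasFDerivAt
  have h2 : HasDerivAt (fun t : ℝ ↦ metricForm m (y + t • u) v w)
      (fderiv ℝ (metricForm m) y u v w) 0 := by
    have h3 := (h1.clm_apply (hasFDerivAt_const v _)).clm_apply (hasFDerivAt_const w _)
    have h4 := h3.comp_hasDerivAt (0 : ℝ) (hasDerivAt_line y u)
    simpa [Function.comp_def] using h4
  have h3 : HasDerivAt (fun t : ℝ ↦ metricForm m (y + t • u) v w)
      (∑ i, -(curv m i / den m y i ^ 3) * (dot i y u * dot i v w)) 0 := by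
    simp only [metricForm_apply]
    refine HasDerivAt.fun_sum fun i _ ↦ ?_
    have hd := (den_pos m y i).ne'
    have hd' : den m (y + (0 : ℝ) • u) i = den m y i := by rw [zero_smul, add_zero]
    refine ((((hasDerivAt_den m y u i).fun_pow 2).fun_inv
      (by rw [hd']; exact pow_ne_zero 2 hd)).mul_const (dot i v w)).congr_deriv ?_
    rw [hd']
    field_simp
    norm_num
    left
    ring
  exact h2.unique h3

theorem koszul_metricForm (m : ℕ) (y u v w : Model n) :
    koszul (metricForm m) y u v w = ∑ i, -(curv m i / den m y i ^ 3) / 2 *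
      (dot i y u * dot i v w + dot i y v * dot i u w - dot i y w * dot i u v) := by
  rw [koszul_apply, fderiv_metricForm, fderiv_metricForm, fderiv_metricForm,
    ← Finset.sum_add_distrib, ← Finset.sum_sub_distrib, Finset.mul_sum]
  refine Finset.sum_congr rfl fun i _ ↦ ?_
  ring

theorem isInvertible_metricForm (m : ℕ) (y : Model n) : (metricForm m y).IsInvertible :=
  isInvertible_of_pos (metricForm_pos m y)

theorem eq_of_metricForm_eq {m : ℕ} {y u v : Model n}
    (h : ∀ w, metricForm m y u w = metricForm m y v w) : u = v := by
  by_contra huv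
  have := metricForm_pos m y (u - v) (sub_ne_zero.2 huv)
  simp [h] at this

theorem christoffel_zero (m : ℕ) (u v : Model n) : christoffel (metricForm m) 0 u v = 0 :=
  eq_of_metricForm_eq (m := m) (y := 0) fun w ↦ by
    simp [apply_christoffel (isInvertible_metricForm m 0), koszul_metricForm]

/-- As `rot` is orthogonal with square `-1`, it is skew for the metric, so the claim reduces to an
identity of Koszul forms. It holds factor by factor because each factor is a conformally flat
surface. -/
theorem parallel_rot (m : ℕ) (y u v : Model n) :
    localCovDerivEnd (metricForm m) (fun _ ↦ rot) y u v = 0 := by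
  have h : christoffel (metricForm m) y u (rot v) = rot (christoffel (metricForm m) y u v) :=
    eq_of_metricForm_eq fun w ↦ by
      have h1 : metricForm m y (rot (christoffel (metricForm m) y u v)) w =
          -metricForm m y (christoffel (metricForm m) y u v) (rot w) := by
        rw [← metricForm_rot m y _ (rot w), rot_rot, map_neg, neg_neg]
      rw [h1, apply_christoffel (isInvertible_metricForm m y),
        apply_christoffel (isInvertible_metricForm m y), koszul_metricForm, koszul_metricForm,
        ← Finset.sum_neg_distrib]
      refine Finset.sum_congr rfl fun i _ ↦ ?_
      simp only [dot_apply, rot_idx_zero, rot_idx_one]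
      ring
  simp [localCovDerivEnd, h]

/-! #### The immersion -/

/-- The linear map through which the immersion in the Lorentzian space is written: the coordinates
`b i` enter the time coordinate, the last coordinate and, for the spherical factors, the
coordinate that is normal to the tangent plane of the sphere at the origin. -/
def assemble {m : ℕ} (hm : m ≤ n) :
    (ℝ × (Fin (2 * n) → ℝ) × (Fin n → ℝ)) →L[ℝ] LorentzSpace (2 * n + (m + 1)) :=
  LinearMap.toContinuousLinearMap
  { toFun := fun q ↦ (q.1 + (∑ i, q.2.2 i) / 2, WithLp.toLp 2 (Fin.append q.2.1
      (Fin.snoc (α := fun _ ↦ ℝ) (fun k ↦ -q.2.2 (Fin.castLE hm k) / 2) ((∑ i, q.2.2 i) / 2))))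
    map_add' := fun q r ↦ by
      refine Prod.ext ?_ (PiLp.ext fun j ↦ ?_)
      · simp only [Prod.fst_add, Prod.snd_add, Pi.add_apply, Finset.sum_add_distrib]
        ring
      · refine Fin.addCases (fun j ↦ ?_) (fun k ↦ ?_) j
        · simp
        · refine Fin.lastCases ?_ (fun k ↦ ?_) k
          · simp only [PiLp.add_apply, Fin.append_right, Fin.snoc_last, Prod.snd_add, Pi.add_apply,
              Finset.sum_add_distrib, add_div]
          · simp [add_div, add_comm]
    map_smul' := fun a q ↦ by
      refine Prod.ext ?_ (PiLp.ext fun j ↦ ?_)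
      · simp only [Prod.smul_fst, Prod.smul_snd, Pi.smul_apply, smul_eq_mul, ← Finset.mul_sum,
          RingHom.id_apply]
        ring
      · refine Fin.addCases (fun j ↦ ?_) (fun k ↦ ?_) j
        · simp
        · refine Fin.lastCases ?_ (fun k ↦ ?_) k
          · simp only [PiLp.smul_apply, Fin.append_right, Fin.snoc_last, Prod.smul_snd,
              Pi.smul_apply, smul_eq_mul, ← Finset.mul_sum, mul_div_assoc, RingHom.id_apply]
          · simp [mul_div_assoc, neg_div] }

theorem assemble_fst {m : ℕ} (hm : m ≤ n) (s : ℝ) (a : Fin (2 * n) → ℝ) (b : Fin n → ℝ) :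
    (assemble hm (s, a, b)).1 = s + (∑ i, b i) / 2 := rfl

/-- The sum of the `b i` enters the time and last coordinates equally, hence along a null direction:
its own square cancels and only its product with `s` remains. The squares of the `b i` survive only
through the sphere normals. -/
theorem lorentz_assemble {m : ℕ} (hm : m ≤ n) (s s' : ℝ) (a a' : Fin (2 * n) → ℝ)
    (b b' : Fin n → ℝ) : lorentz (assemble hm (s, a, b)) (assemble hm (s', a', b')) =
      ∑ j, a j * a' j + (∑ i, curv m i * (b i * b' i)) / 4 - s * s'
        - (s * ∑ i, b' i + s' * ∑ i, b i) / 2 := by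
  have h : ∀ k : Fin m, -b (Fin.castLE hm k) / 2 * (-b' (Fin.castLE hm k) / 2) =
      1 / 4 * (b (Fin.castLE hm k) * b' (Fin.castLE hm k)) := fun k ↦ by ring
  rw [lorentz, assemble_fst, assemble_fst, PiLp.inner_apply, Fin.sum_univ_add,
    Fin.sum_univ_castSucc, sum_curv_mul hm]
  simp only [assemble, LinearMap.coe_toContinuousLinearMap', LinearMap.coe_mk, AddHom.coe_mk,
    Fin.append_left, Fin.append_right, Fin.snoc_castSucc, Fin.snoc_last, RCLike.inner_apply,
    conj_trivial, mul_comm (a' _), mul_comm (-b' _ / 2), h, ← Finset.mul_sum]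
  ring

/-- Stereographic coordinates of the factors. -/
def stereo (m : ℕ) (y : Model n) : ℝ × (Fin (2 * n) → ℝ) × (Fin n → ℝ) :=
  (1, fun j ↦ y j / den m y (factor j), fun i ↦ dot i y y / den m y i)

/-- The derivative of `stereo`. -/
def stereoDeriv (m : ℕ) (y u : Model n) : ℝ × (Fin (2 * n) → ℝ) × (Fin n → ℝ) :=
  (0, fun j ↦ u j / den m y (factor j) - y j * (curv m (factor j) * dot (factor j) y u / 2) /
    den m y (factor j) ^ 2, fun i ↦ 2 * dot i y u / den m y i ^ 2)

theorem contDiff_stereo (m : ℕ) {k : ℕ∞ω} : ContDiff ℝ k (stereo (n := n) m) := by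
  refine contDiff_const.prodMk ((contDiff_pi.2 fun j ↦ ?_).prodMk (contDiff_pi.2 fun i ↦ ?_))
  · exact ContDiff.div (by fun_prop) (contDiff_den m _) fun y ↦ (den_pos m y _).ne'
  · exact ContDiff.div (by fun_prop) (contDiff_den m _) fun y ↦ (den_pos m y _).ne'

theorem hasDerivAt_coord (y u : Model n) (j : Fin (2 * n)) :
    HasDerivAt (fun t : ℝ ↦ (y + t • u) j) (u j) 0 := by
  simpa using ((hasDerivAt_id (0 : ℝ)).mul_const (u j)).const_add (y j)

theorem hasDerivAt_dot_left (y u w : Model n) (i : Fin n) :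
    HasDerivAt (fun t : ℝ ↦ dot i (y + t • u) w) (dot i u w) 0 := by
  simpa using ((hasDerivAt_id (0 : ℝ)).mul_const (dot i u w)).const_add (dot i y w)

theorem hasDerivAt_dot_self (y u : Model n) (i : Fin n) :
    HasDerivAt (fun t : ℝ ↦ dot i (y + t • u) (y + t • u)) (2 * dot i y u) 0 := by
  refine (((hasDerivAt_coord y u (idx 0 i)).fun_mul (hasDerivAt_coord y u (idx 0 i))).fun_add
    ((hasDerivAt_coord y u (idx 1 i)).fun_mul (hasDerivAt_coord y u (idx 1 i)))).congr_deriv ?_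
  simp only [dot_apply, zero_smul, add_zero]
  ring

theorem fderiv_stereo (m : ℕ) (y u : Model n) : fderiv ℝ (stereo m) y u = stereoDeriv m y u := by
  have h1 : HasFDerivAt (stereo m) (fderiv ℝ (stereo m) y) (y + (0 : ℝ) • u) := by
    rw [zero_smul, add_zero]
    exact ((contDiff_stereo (k := 1) m).differentiable (by simp) y).hasFDerivAt
  have hd' : ∀ i, den m (y + (0 : ℝ) • u) i = den m y i := fun i ↦ by rw [zero_smul, add_zero]
  have hd := fun i ↦ (den_pos m y i).ne'
  refine (h1.comp_hasDerivAt (0 : ℝ) (hasDerivAt_line y u)).unique ?_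
  refine (hasDerivAt_const _ _).prodMk ((hasDerivAt_pi.2 fun j ↦ ?_).prodMk
    (hasDerivAt_pi.2 fun i ↦ ?_))
  · refine ((hasDerivAt_coord y u j).fun_div (hasDerivAt_den m y u (factor j))
      (by rw [hd']; exact hd _)).congr_deriv ?_
    have := hd (factor j)
    rw [hd', zero_smul, add_zero]
    field_simp
  · refine ((hasDerivAt_dot_self y u i).fun_div (hasDerivAt_den m y u i)
      (by rw [hd']; exact hd _)).congr_deriv ?_
    have := hd i
    rw [hd', zero_smul, add_zero]
    field_simp
    rw [den]
    ring

/-- The immersion as a map in the Lorentzian space. -/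
def immersion {m : ℕ} (hm : m ≤ n) (y : Model n) : LorentzSpace (2 * n + (m + 1)) :=
  assemble hm (stereo m y)

theorem contDiff_immersion {m : ℕ} (hm : m ≤ n) {k : ℕ∞ω} : ContDiff ℝ k (immersion hm) :=
  (assemble hm).contDiff.comp (contDiff_stereo m)

theorem fderiv_immersion {m : ℕ} (hm : m ≤ n) (y u : Model n) :
    fderiv ℝ (immersion hm) y u = assemble hm (stereoDeriv m y u) := by
  have h := ((assemble hm).hasFDerivAt.comp y
    ((contDiff_stereo (k := 1) m).differentiable (by simp) y).hasFDerivAt).fderiv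
  rw [← fderiv_stereo]
  exact congrArg (fun T ↦ T u) h

/-- With `b i = |y_i|² / den`, the squared Euclidean norm of the point in the `i`-th factor is
exactly `b i`, which cancels the cross term of `lorentz_assemble`. -/
theorem lorentz_immersion {m : ℕ} (hm : m ≤ n) (y : Model n) :
    lorentz (immersion hm y) (immersion hm y) = -1 := by
  rw [immersion, stereo, lorentz_assemble, sum_idx]
  have h : ∑ i : Fin n, (y (idx 0 i) / den m y (factor (idx 0 i)) *
      (y (idx 0 i) / den m y (factor (idx 0 i))) + y (idx 1 i) / den m y (factor (idx 1 i)) *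
      (y (idx 1 i) / den m y (factor (idx 1 i)))) + (∑ i, curv m i * (dot i y y / den m y i *
      (dot i y y / den m y i))) / 4 = ∑ i, dot i y y / den m y i := by
    rw [Finset.sum_div, ← Finset.sum_add_distrib]
    refine Finset.sum_congr rfl fun i _ ↦ ?_
    have hd := (den_pos m y i).ne'
    simp only [factor_idx]
    field_simp
    rw [den, dot_apply]
    ring
  rw [h]
  ring

theorem immersion_fst_pos {m : ℕ} (hm : m ≤ n) (y : Model n) : 0 < (immersion hm y).1 := by
  rw [immersion, stereo, assemble_fst]
  have : 0 ≤ ∑ i, dot i y y / den m y i :=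
    Finset.sum_nonneg fun i _ ↦ div_nonneg (dot_self_nonneg i y) (den_pos m y i).le
  positivity

theorem lorentz_fderiv_immersion {m : ℕ} (hm : m ≤ n) (y u v : Model n) :
    lorentz (fderiv ℝ (immersion hm) y u) (fderiv ℝ (immersion hm) y v) = metricForm m y u v := by
  rw [fderiv_immersion, fderiv_immersion, stereoDeriv, stereoDeriv, lorentz_assemble, sum_idx,
    metricForm_apply]
  simp only [zero_mul, add_zero, sub_zero, zero_div, factor_idx]
  rw [Finset.sum_div, ← Finset.sum_add_distrib]
  refine Finset.sum_congr rfl fun i _ ↦ ?_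
  have hd := (den_pos m y i).ne'
  have hden : den m y i = 1 + curv m i * dot i y y / 4 := rfl
  simp only [dot_apply] at hden ⊢
  generalize den m y i = D at *
  field_simp
  subst hden
  ring

theorem fderiv_fderiv_immersion_zero {m : ℕ} (hm : m ≤ n) (u w : Model n) :
    fderiv ℝ (fderiv ℝ (immersion hm)) 0 u w = assemble hm (0, 0, fun i ↦ 2 * dot i u w) := by
  have h1 : HasFDerivAt (fderiv ℝ (immersion hm)) (fderiv ℝ (fderiv ℝ (immersion hm)) 0)
      (0 + (0 : ℝ) • u) := by
    rw [zero_smul, add_zero]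
    exact (((contDiff_immersion (k := 2) hm).fderiv_right (m := 1)
      (by norm_num)).differentiable (by simp) 0).hasFDerivAt
  have h2 : HasDerivAt (fun t : ℝ ↦ fderiv ℝ (immersion hm) (0 + t • u) w)
      (fderiv ℝ (fderiv ℝ (immersion hm)) 0 u w) 0 := by
    have h3 := (h1.clm_apply (hasFDerivAt_const w _)).comp_hasDerivAt (0 : ℝ) (hasDerivAt_line 0 u)
    simpa [Function.comp_def] using h3
  refine h2.unique ?_
  simp only [fderiv_immersion]
  refine (assemble hm).hasFDerivAt.comp_hasDerivAt (0 : ℝ) ?_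
  have hd' : ∀ i, den m (0 + (0 : ℝ) • u) i = 1 := fun i ↦ by rw [zero_smul, add_zero, den_zero]
  refine (hasDerivAt_const _ _).prodMk ((hasDerivAt_pi.2 fun j ↦ ?_).prodMk
    (hasDerivAt_pi.2 fun i ↦ ?_))
  · have hden := hasDerivAt_den m 0 u (factor j)
    refine (((hasDerivAt_const (0 : ℝ) (w j)).fun_div hden (by rw [hd']; norm_num)).fun_sub
      (((hasDerivAt_coord 0 u j).fun_mul (((hasDerivAt_dot_left 0 u w (factor j)).const_mul
      (curv m (factor j))).div_const 2)).fun_div (hden.fun_pow 2)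
      (by rw [hd']; norm_num))).congr_deriv ?_
    simp
  · refine (((hasDerivAt_dot_left 0 u w i).const_mul 2).fun_div
      ((hasDerivAt_den m 0 u i).fun_pow 2) (by rw [hd']; norm_num)).congr_deriv ?_
    simp [den_zero]

end SphereProduct

/-! ### Smooth tensor fields on a vector space -/

section ModelSections

variable {F : Type*} [NormedAddCommGroup F] [NormedSpace ℝ F]

/-- A smooth field of endomorphisms of a vector space is a smooth section. -/
theorem contMDiff_end_section {T : F → F →L[ℝ] F} (hT : ContDiff ℝ ∞ T) :
    ContMDiff 𝓘(ℝ, F) (𝓘(ℝ, F).prod 𝓘(ℝ, F →L[ℝ] F)) ∞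
    (fun x : F ↦ Bundle.TotalSpace.mk' (F →L[ℝ] F)
      (E := fun x : F ↦ TangentSpace 𝓘(ℝ, F) x →L[ℝ] TangentSpace 𝓘(ℝ, F) x) x (T x)) := by
  intro x
  refine (contMDiffAt_hom_bundle _).2 ⟨contMDiffAt_id, ?_⟩
  refine hT.contMDiff.contMDiffAt.congr_of_eventuallyEq (Eventually.of_forall fun y ↦ ?_)
  exact inCoordinates_tangent_bundle_core_model_space (I := 𝓘(ℝ, F)) (I' := 𝓘(ℝ, F)) x y x y (T y)

/-- A smooth field of bilinear forms on a vector space is a smooth section. -/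
theorem contMDiff_form_section {T : F → F →L[ℝ] F →L[ℝ] ℝ} (hT : ContDiff ℝ ∞ T) :
    ContMDiff 𝓘(ℝ, F) (𝓘(ℝ, F).prod 𝓘(ℝ, F →L[ℝ] F →L[ℝ] ℝ)) ∞
    (fun x : F ↦ Bundle.TotalSpace.mk' (F →L[ℝ] F →L[ℝ] ℝ)
      (E := fun x : F ↦ TangentSpace 𝓘(ℝ, F) x →L[ℝ] TangentSpace 𝓘(ℝ, F) x →L[ℝ] ℝ)
        x (T x)) := by
  have key : ∀ (S : ∀ x : F, TangentSpace 𝓘(ℝ, F) x →L[ℝ] TangentSpace 𝓘(ℝ, F) x →L[ℝ] ℝ)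
      (x y v w : F), (trivializationAt (F →L[ℝ] F →L[ℝ] ℝ) (fun x : F ↦ TangentSpace 𝓘(ℝ, F) x
        →L[ℝ] TangentSpace 𝓘(ℝ, F) x →L[ℝ] ℝ) x ⟨y, S y⟩).2 v w = S y v w := by
    intro S x y v w
    have hs : (trivializationAt F (TangentSpace 𝓘(ℝ, F)) x).symmL ℝ y =
        ContinuousLinearMap.id ℝ F := by
      rw [TangentBundle.symmL_model_space]
      rfl
    simp only [hom_trivializationAt_apply, ContinuousLinearMap.inCoordinates]
    rw [ContinuousLinearMap.comp_apply, ContinuousLinearMap.comp_apply, hs]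
    simp only [Bundle.Trivialization.continuousLinearMapAt_apply,
      Bundle.Trivialization.linearMapAt_apply, hom_trivializationAt_apply,
      ContinuousLinearMap.inCoordinates, hs]
    rw [if_pos]
    · simp
      rfl
    · simp
      exact Set.mem_univ y
  intro x
  refine (Bundle.contMDiffAt_section x).2 ?_
  refine hT.contMDiff.contMDiffAt.congr_of_eventuallyEq (Eventually.of_forall fun y ↦ ?_)
  ext v w
  exact key T x y v w

end ModelSections

namespace SphereProduct

variable {n : ℕ}

attribute [local instance] chartedSpaceSelf

/-! #### The Kaehler structure -/

/-- The product metric as a Riemannian metric on `Model n`. -/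
def metric (n m : ℕ) : RiemannianMetric n (Model n) where
  inner y := metricForm m y
  symm y u v := metricForm_symm m y u v
  pos y u hu := metricForm_pos m y u hu
  isVonNBounded y := by
    change Bornology.IsVonNBounded ℝ {v : Model n | metricForm m y v v < 1}
    refine (NormedSpace.isVonNBounded_ball ℝ (Model n) (1 + ‖y‖ ^ 2 / 4)).subset fun v hv ↦ ?_
    rw [mem_ball_zero_iff]
    have h0 : 0 < 1 + ‖y‖ ^ 2 / 4 := by positivity
    have h1 : ‖v‖ ^ 2 < (1 + ‖y‖ ^ 2 / 4) ^ 2 :=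
      (norm_sq_le_metricForm m y v).trans_lt (mul_lt_of_lt_one_right (pow_pos h0 2) hv)
    exact lt_of_pow_lt_pow_left₀ 2 h0.le h1
  contMDiff := contMDiff_form_section (contDiff_metricForm m)

theorem chartSymmDeriv_model (x y u : Model n) : (chartSymmDeriv x y u : Model n) = u := by
  have h : chartSymmDeriv x y = ContinuousLinearMap.id ℝ (Model n) := mfderiv_id
  exact congrArg (fun T : Model n →L[ℝ] Model n ↦ T u) h

theorem chartDeriv_model (x y u : Model n) :
    (chartDeriv x y : Model n →L[ℝ] Model n) u = u := by
  have h : chartDeriv x y = ContinuousLinearMap.id ℝ (Model n) := mfderiv_id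
  exact congrArg (fun T : Model n →L[ℝ] Model n ↦ T u) h

theorem chartMetric_metric (m : ℕ) (x : Model n) : chartMetric (metric n m) x = metricForm m := by
  ext y u v
  exact congrArg₂ (fun a b : Model n ↦ metricForm m y a b) (chartSymmDeriv_model x y u)
    (chartSymmDeriv_model x y v)

theorem chartEnd_rot (x : Model n) :
    chartEnd (n := n) (fun _ : Model n ↦ (rot : Model n →L[ℝ] Model n)) x = fun _ ↦ rot := by
  ext1 y
  ext1 u
  exact (chartDeriv_model x y _).trans (congrArg rot (chartSymmDeriv_model x y u))

/-- The product of `m` unit spheres (in stereographic coordinates) and `n - m` planes. -/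
def kaehlerStructure (n m : ℕ) : KaehlerStructure n (Model n) where
  metric := metric n m
  J _ := rot
  contMDiff_J := contMDiff_end_section contDiff_const
  J_J _ u := rot_rot u
  inner_J_J y u v := metricForm_rot m y u v
  parallel_J x₀ y _ u v := by
    rw [chartMetric_metric, chartEnd_rot]
    exact parallel_rot m y u v

/-- The immersion in the hyperbolic space. -/
def hyperbolicImmersion {m : ℕ} (hm : m ≤ n) (y : Model n) :
    HyperbolicSpace (2 * n + (m + 1)) :=
  ⟨immersion hm y, lorentz_immersion hm y, immersion_fst_pos hm y⟩

theorem isIsometricImmersion {m : ℕ} (hm : m ≤ n) :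
    IsIsometricImmersion (metric n m) (hyperbolicImmersion hm) where
  contMDiff := (contDiff_immersion hm).contMDiff
  isometric x u v := by
    rw [mfderiv_eq_fderiv]
    exact lorentz_fderiv_immersion hm x u v

/-! #### The curvature at the origin -/

/-- At the origin the Christoffel symbols vanish, so the Hessian is the plain second derivative,
which has only `b` components. Its Lorentzian products see the spherical factors alone, and the
Gauss equation applies. -/
theorem metricForm_localCurvature_zero {m : ℕ} (hm : m ≤ n) (u v w t : Model n) :
    metricForm m 0 (localCurvature (metricForm m) 0 u v w) t =
      ∑ i, curv m i * (dot i v w * dot i u t - dot i u w * dot i v t) := by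
  have H : IsLocalImmersion (lorentzForm _) (immersion hm) (metricForm m) 0 :=
    { form_symm := lorentz_comm
      contDiffAt := (contDiff_immersion hm).contDiffAt
      metric_eq := Eventually.of_forall fun y ↦ by
        ext u v
        exact (lorentz_fderiv_immersion hm y u v).symm
      metric_pos := metricForm_pos m 0 }
  rw [H.gauss]
  simp only [hessian_apply, christoffel_zero, map_zero, sub_zero, fderiv_fderiv_immersion_zero,
    lorentzForm_apply, lorentz_assemble, Pi.zero_apply, zero_mul, Finset.sum_const_zero, zero_add,
    add_zero, zero_div]
  rw [← sub_div, ← Finset.sum_sub_distrib, Finset.sum_div]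
  refine Finset.sum_congr rfl fun i _ ↦ ?_
  ring

theorem localCurvature_rot {m : ℕ} (hm : m ≤ n) (S : Model n) :
    metricForm m 0 (localCurvature (metricForm m) 0 S (rot S) (rot S)) S =
      ∑ i, curv m i * dot i S S ^ 2 := by
  rw [metricForm_localCurvature_zero hm]
  refine Finset.sum_congr rfl fun i _ ↦ ?_
  rw [dot_rot_rot, dot_rot_self]
  ring

theorem trace_localCurvature {m : ℕ} (hm : m ≤ n) (S : Model n) (A : Model n →ₗ[ℝ] Model n)
    (hA : ∀ X, A X = localCurvature (metricForm m) 0 X S S) :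
    LinearMap.trace ℝ (Model n) A = ∑ i, curv m i * dot i S S := by
  have he : IsOrthonormalBasis (metricForm m (0 : Model n)).toLinearMap₁₂
      (EuclideanSpace.basisFun (Fin (2 * n)) ℝ).toBasis := fun i j ↦ by
    change metricForm m 0 _ _ = _
    rw [metricForm_zero, sum_dot]
    simp [EuclideanSpace.inner_single_left]
  rw [he.trace_eq_sum]
  change ∑ j, metricForm m 0 (A _) _ = _
  simp only [hA, metricForm_localCurvature_zero hm]
  rw [Finset.sum_comm]
  refine Finset.sum_congr rfl fun i _ ↦ ?_
  rw [← Finset.mul_sum, sum_idx]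
  congr 1
  rw [Finset.sum_eq_single i]
  · simp [dot_apply, idx_inj]
    ring
  · intro k _ hk
    simp [dot_apply, idx_inj, hk.symm]
  · simp

theorem eq_zero_of_sum_curv_mul_nonpos {m : ℕ} {φ : Fin n → ℝ} (h0 : ∀ i, 0 ≤ φ i)
    (h : ∑ i, curv m i * φ i ≤ 0) (i : Fin n) (hi : (i : ℕ) < m) : φ i = 0 := by
  have h1 : ∀ i ∈ Finset.univ, 0 ≤ curv m i * φ i := fun i _ ↦ mul_nonneg (curv_nonneg m i) (h0 i)
  have h2 := (Finset.sum_eq_zero_iff_of_nonneg h1).1 (h.antisymm (Finset.sum_nonneg h1)) i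
    (Finset.mem_univ i)
  simpa [curv, hi] using h2

/-- A subspace of vectors without components in the spherical factors has dimension at most
`2 * (n - m)`. -/
theorem finrank_le_of_dot_eq_zero {m : ℕ} (hm : m ≤ n) (V : Submodule ℝ (Model n))
    (hV : ∀ S ∈ V, ∀ i : Fin n, (i : ℕ) < m → dot i S S = 0) :
    Module.finrank ℝ V ≤ 2 * (n - m) := by
  let e : Model n →ₗ[ℝ] Fin 2 × Fin m → ℝ := LinearMap.pi fun k ↦
    (EuclideanSpace.proj (idx k.1 (Fin.castLE hm k.2)) : Model n →L[ℝ] ℝ).toLinearMap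
  have he : ∀ S k, e S k = S (idx k.1 (Fin.castLE hm k.2)) := fun _ _ ↦ rfl
  have hsurj : LinearMap.range e = ⊤ := by
    rw [LinearMap.range_eq_top]
    intro φ
    refine ⟨WithLp.toLp 2 fun j ↦ if h : (factor j : ℕ) < m then φ (side j, ⟨factor j, h⟩) else 0,
      funext fun k ↦ ?_⟩
    simp [he]
  have h1 := e.finrank_range_add_finrank_ker
  rw [hsurj, finrank_top, Module.finrank_fintype_fun_eq_card, finrank_euclideanSpace_fin,
    Fintype.card_prod, Fintype.card_fin, Fintype.card_fin] at h1
  have h2 : V ≤ LinearMap.ker e := by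
    intro S hS
    rw [LinearMap.mem_ker]
    ext ⟨s, k⟩
    have h3 := hV S hS (Fin.castLE hm k) k.2
    rw [dot_apply] at h3
    have h4 : S (idx 0 (Fin.castLE hm k)) = 0 ∧ S (idx 1 (Fin.castLE hm k)) = 0 :=
      mul_self_add_mul_self_eq_zero.1 h3
    rw [he]
    fin_cases s
    exacts [h4.1, h4.2]
  have h3 := Submodule.finrank_mono h2
  omega

theorem curvature_metric (m : ℕ) (u v w : Model n) :
    curvature (metric n m) (0 : Model n) u v w = localCurvature (metricForm m) 0 u v w := by
  change localCurvature (chartMetric (metric n m) 0) (0 : Model n) u v w = _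
  rw [chartMetric_metric]

theorem sectionalCurvature_metric {m : ℕ} (hm : m ≤ n) (S : Model n) :
    sectionalCurvature (metric n m) (0 : Model n) S (rot S) =
      (∑ i, curv m i * dot i S S ^ 2) / (metricForm m 0 S S * metricForm m 0 S S) := by
  have h1 : metricForm m 0 S (rot S) = 0 := by simp [metricForm_apply, dot_rot_self]
  have h2 : sectionalCurvature (metric n m) (0 : Model n) S (rot S) =
      metricForm m 0 (localCurvature (metricForm m) 0 S (rot S) (rot S)) S /
      (metricForm m 0 S S * metricForm m 0 (rot S) (rot S) - metricForm m 0 S (rot S) ^ 2) :=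
    congrArg (fun X : Model n ↦ metricForm m 0 X S / (metricForm m 0 S S *
      metricForm m 0 (rot S) (rot S) - metricForm m 0 S (rot S) ^ 2))
      (curvature_metric m S (rot S) (rot S))
  rw [h2, localCurvature_rot hm, metricForm_rot, h1, zero_pow two_ne_zero, sub_zero]

theorem ricci_metric {m : ℕ} (hm : m ≤ n) (S : Model n) :
    ricci (metric n m) (0 : Model n) S = ∑ i, curv m i * dot i S S :=
  trace_localCurvature hm S (curvatureOperator (metric n m) (0 : Model n) S S)
    fun X ↦ curvature_metric m X S S

/-- Both curvatures have the sign of a sum, over the spherical factors, of nonnegative powers of the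
component norms of `S`. If such a sum is nonpositive, every spherical component vanishes and `V`
lies in the flat factors. -/
theorem isComplexSubspace_le {m : ℕ} (hm : m ≤ n) (ℓ : ℕ)
    (V : Submodule ℝ (TangentSpace 𝓘(ℝ, Model n) (0 : Model n)))
    (hV : (kaehlerStructure n m).IsComplexSubspace 0 V ℓ) :
    ((∀ S ∈ V, S ≠ 0 → sectionalCurvature (kaehlerStructure n m).metric 0 S
      ((kaehlerStructure n m).J 0 S) ≤ 0) → ℓ ≤ n - m) ∧
    ((∀ S ∈ V, ricci (kaehlerStructure n m).metric 0 S ≤ 0) → ℓ ≤ n - m) := by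
  have key : (∀ S : Model n, S ∈ V → ∀ i : Fin n, (i : ℕ) < m → dot i S S = 0) → ℓ ≤ n - m :=
    fun h ↦ by
      have h1 := finrank_le_of_dot_eq_zero hm V h
      have h2 : Module.finrank ℝ V = 2 * ℓ := hV.2
      exact Nat.le_of_mul_le_mul_left (h2.symm.trans_le h1) two_pos
  refine ⟨fun h ↦ key fun S hS i hi ↦ ?_, fun h ↦ key fun S hS ↦ ?_⟩
  · by_cases hS0 : S = 0
    · simp [hS0]
    have h1 := (sectionalCurvature_metric hm S).symm.trans_le (h S hS hS0)
    have h3 := metricForm_pos m 0 S hS0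
    have h4 := nonpos_of_mul_nonpos_left ((div_eq_mul_inv _ _).symm.trans_le h1)
      (inv_pos.2 (mul_pos h3 h3))
    exact pow_eq_zero_iff two_ne_zero |>.1
      (eq_zero_of_sum_curv_mul_nonpos (φ := fun i ↦ dot i S S ^ 2) (fun i ↦ sq_nonneg _) h4 i hi)
  · exact eq_zero_of_sum_curv_mul_nonpos (φ := fun i ↦ dot i S S) (fun i ↦ dot_self_nonneg i S)
      ((ricci_metric hm S).symm.trans_le (h S hS))

end SphereProduct

end KaehlerHyperbolic

end

open KaehlerHyperbolic in
theorem theorem2 (n p : ℕ) (hp : 1 ≤ p) (hpn : p + 2 ≤ n) :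
    -- the estimate
    (∀ (M : Type*) [TopologicalSpace M] [ChartedSpace (Model n) M]
      [IsManifold 𝓘(ℝ, Model n) ∞ M] (K : KaehlerStructure n M)
      (f : M → HyperbolicSpace (2 * n + p)), IsIsometricImmersion K.metric f →
      ∀ x : M, ∃ (ℓ : ℕ) (V : Submodule ℝ (TangentSpace 𝓘(ℝ, Model n) x)),
        n - p + 1 ≤ ℓ ∧ K.IsComplexSubspace x V ℓ ∧
        ∀ S ∈ V, (S ≠ 0 → sectionalCurvature K.metric x S (K.J x S) ≤ 0) ∧
          ricci K.metric x S ≤ 0) ∧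
    -- its sharpness, for each of the two curvatures
    (∃ (M : Type) (_ : TopologicalSpace M) (_ : T2Space M) (_ : SecondCountableTopology M)
      (_ : ConnectedSpace M) (_ : ChartedSpace (Model n) M) (_ : IsManifold 𝓘(ℝ, Model n) ∞ M)
      (K : KaehlerStructure n M) (f : M → HyperbolicSpace (2 * n + p)),
      IsIsometricImmersion K.metric f ∧
      ∃ x : M, ∀ (ℓ : ℕ) (V : Submodule ℝ (TangentSpace 𝓘(ℝ, Model n) x)),
        K.IsComplexSubspace x V ℓ →
        ((∀ S ∈ V, S ≠ 0 → sectionalCurvature K.metric x S (K.J x S) ≤ 0) → ℓ ≤ n - p + 1) ∧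
        ((∀ S ∈ V, ricci K.metric x S ≤ 0) → ℓ ≤ n - p + 1)) := by
  refine ⟨fun M _ _ _ K f hf x ↦ hf.exists_complex_subspace hpn K x, ?_⟩
  -- Each of the `m = p - 1` spheres costs one codimension, and the horosphere costs the last one.
  obtain ⟨m, rfl⟩ : ∃ m, p = m + 1 := ⟨p - 1, by omega⟩
  have hm : m ≤ n := by omega
  have hnm : n - (m + 1) + 1 = n - m := by omega
  rw [hnm]
  exact ⟨Model n, inferInstance, inferInstance, inferInstance, inferInstance,
    chartedSpaceSelf _, inferInstance, SphereProduct.kaehlerStructure n m,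
    SphereProduct.hyperbolicImmersion hm, SphereProduct.isIsometricImmersion hm, 0,
    SphereProduct.isComplexSubspace_le hm⟩
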